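/- Let $\mathbb D=\{|z|<1\}$ and $\mathbb T=\partial\mathbb D$. A holomorphic function element is a pair $(U,f)$ with $U\subset\mathbb C$ open and simply connected and $f:U\to\mathbb C$ holomorphic. Two elements are connectable if they are joined by a finite chain of elements in which consecutive domains meet and consecutive functions agree on the intersection of their domains. The boundary of $U$ is a natural boundary for $(U,f)$ if every element connectable to a restriction of $(U,f)$ has its domain contained in $U$. A regular analytic continuation of $(U,f)$ is a quadruple $(S,\pi,j,F)$, where $S$ is a connected Riemann surface, $\pi:S\to\mathbb C$ is a local biholomorphism, $j:U\to S$ is holomorphic with $\pi\circ j=\mathrm{id}_U$, and $F:S\to\mathbb C$ is holomorphic with $F\circ j=f$. It is maximal if for every other regular analytic continuation $(S',\pi',j',F')$ of $(U,f)$ there is a holomorphic map $\varphi:S'\to S$ with $\pi\circ\varphi=\pi'$, $\varphi\circ j'=j$ and $F\circ\varphi=F'$. Then the following holds. (0) There is a sequence $(a_n)_{n\ge 0}$ of pairwise distinct points of $\mathbb D$ such that $\sum_n(1-|a_n|)<\infty$, $(a_n)$ accumulates at every point of $\mathbb T$, and $|a_{2n}-a_{2n+1}|\le(1-|a_{2n}|)^2$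 for all $n$. Let $(a_n)$ be any such sequence. (1) With the constants $c_n=-|a_n|/a_n$ ($c_n=1$ if $a_n=0$) the Blaschke product $\prod_{n}c_n\frac{z-a_n}{1-\overline{a_n}z}$ converges uniformly on compact subsets of $\mathbb D$. Let $c_n$ be any constants with $|c_n|=1$ for which the partial products $\prod_{n<N}c_n\frac{z-a_n}{1-\overline{a_n}z}$ converge uniformly on compact subsets of $\mathbb D$ as $N\to\infty$, and let $B$ be the limit. (2) $B$ is holomorphic, $B(\mathbb D)\subset\mathbb D$, the zeros of $B$ in $\mathbb D$ are exactly the points $a_n$, all of them simple, and $\mathbb T$ is a natural boundary for $B$. (3) For every $n$ there is exactly one germ $f_n$ of a holomorphic function at $0$ with $f_n(0)=a_n$ and $B(f_n(w))=w$ near $0$. If $r_n$ denotes the radius of convergence of its Taylor series at $0$, then $f_n$ extends to an injective holomorphic map from $\{|w|<r_n\}$ into $\mathbb D$. Any two function elements that represent germs $f_m$ and $f_n$ at $0$ are connectable. (4) For every $n$, $$r_{2n}\le\frac{4|a_{2n}-a_{2n+1}|}{1-|a_{2n}|},\qquad r_{2n}\le 4(1-|a_{2n}|),$$ and $r_{2n}\to0$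 as $n\to\infty$. (5) For every $n$, every function element that represents the germ $f_n$ at $0$ has a maximal regular analytic continuation, and for every maximal regular analytic continuation $(S,\pi,j,F)$ of it the projection $\pi:S\to\pi(S)$ is not a topological covering. -/

import Mathlib

open scoped Manifold ContDiff Topology ENNReal

universe u

/-! ### Sequences in the unit disc and Blaschke products -/

/-- Pairwise distinct points `a n` of the open unit disc that satisfy the Blaschke condition,
accumulate at every point of the unit circle, and come in close pairs. -/
structure IsPairedBlaschkeSequence (a : ℕ → ℂ) : Prop where
  mem_disc : ∀ n, a n ∈ Metric.ball (0 : ℂ) 1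
  injective : Function.Injective a
  summable : Summable fun n => 1 - ‖a n‖
  accumulates : ∀ p ∈ Metric.sphere (0 : ℂ) 1, MapClusterPt p Filter.atTop a
  close : ∀ n, ‖a (2 * n) - a (2 * n + 1)‖ ≤ (1 - ‖a (2 * n)‖) ^ 2

/-- The `N`-th partial product of `∏ c n * (z - a n) / (1 - conj (a n) * z)`. -/
noncomputable def blaschkePartialProduct (a c : ℕ → ℂ) (N : ℕ) (z : ℂ) : ℂ :=
  ∏ n ∈ Finset.range N, c n * ((z - a n) / (1 - (starRingEnd ℂ) (a n) * z))

/-- `B` is, on the open unit disc, the Blaschke product with zeros `a n` and unimodular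
normalizing constants `c n`, the product converging uniformly on compact subsets. -/
def IsBlaschkeProduct (a c : ℕ → ℂ) (B : ℂ → ℂ) : Prop :=
  (∀ n, ‖c n‖ = 1) ∧
    TendstoLocallyUniformlyOn (blaschkePartialProduct a c) B Filter.atTop (Metric.ball 0 1)

/-- The customary normalizing constant `-|a| / a` (and `1` for `a = 0`). -/
noncomputable def blaschkeConst (a : ℂ) : ℂ :=
  if a = 0 then 1 else -((‖a‖ : ℂ) / a)

/-! ### Holomorphic function elements and analytic continuation -/

/-- A holomorphic function element `(U, f)`: `U` is a simply connected open subset of `ℂ` and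
`f` is holomorphic on `U` (values outside `U` are irrelevant). -/
structure HolElement where
  dom : TopologicalSpace.Opens ℂ
  simplyConnected : SimplyConnectedSpace dom
  toFun : ℂ → ℂ
  holo : DifferentiableOn ℂ toFun dom

namespace HolElement

/-- The domains meet and the functions agree on the intersection. -/
def Linked (E E' : HolElement) : Prop :=
  ((E.dom : Set ℂ) ∩ E'.dom).Nonempty ∧ Set.EqOn E.toFun E'.toFun ((E.dom : Set ℂ) ∩ E'.dom)

/-- `E` and `E'` are joined by a finite chain of successively linked elements. -/
def Connectable (E E' : HolElement) : Prop :=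
  Relation.ReflTransGen Linked E E'

/-- The boundary of the domain of `E` is a natural boundary: no analytic continuation of a
restriction of `E` leaves the domain of `E`. -/
def HasNaturalBoundary (E : HolElement) : Prop :=
  ∀ V W : HolElement, V.dom ≤ E.dom → Set.EqOn V.toFun E.toFun V.dom → Connectable V W →
    W.dom ≤ E.dom

/-- `E` is a branch of the inverse of `B` at `0` with value `b` at `0`. -/
def IsInverseBranch (B : ℂ → ℂ) (b : ℂ) (E : HolElement) : Prop :=
  (0 : ℂ) ∈ E.dom ∧ E.toFun 0 = b ∧ ∀ᶠ w in 𝓝 (0 : ℂ), B (E.toFun w) = w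

end HolElement

/-- The radius of convergence of the Taylor series of `f` at `z`. -/
noncomputable def taylorRadius (f : ℂ → ℂ) (z : ℂ) : ℝ≥0∞ :=
  (FormalMultilinearSeries.ofScalars ℂ
    (fun k : ℕ => ((k.factorial : ℂ)⁻¹ * iteratedDeriv k f z))).radius

/-- A regular analytic continuation `(S, π, j, F)` of the element `(U, f)`: a (connected,
Hausdorff) Riemann surface `S`, a local biholomorphism `π : S → ℂ` (onto its open image), a
holomorphic map `j : U → S` with `π ∘ j = id` and a holomorphic function `F : S → ℂ` with
`F ∘ j = f`. -/
structure RegularContinuation (E : HolElement) where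
  S : Type u
  [top : TopologicalSpace S]
  [t2 : T2Space S]
  [connected : ConnectedSpace S]
  [charted : ChartedSpace ℂ S]
  [manifold : IsManifold 𝓘(ℂ) ω S]
  proj : S → ℂ
  proj_local : IsLocalDiffeomorph 𝓘(ℂ) 𝓘(ℂ) ω proj
  incl : E.dom → S
  incl_holo : MDifferentiable 𝓘(ℂ) 𝓘(ℂ) incl
  proj_incl : ∀ z, proj (incl z) = z
  F : S → ℂ
  F_holo : MDifferentiable 𝓘(ℂ) 𝓘(ℂ) F
  F_incl : ∀ z, F (incl z) = E.toFun z

namespace RegularContinuation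

attribute [instance] top t2 connected charted manifold

/-- `Q` is maximal: every regular analytic continuation of the same element maps
holomorphically to `Q`, compatibly with all the data. (Such a map is unique, and a maximal
continuation is therefore unique up to isomorphism.) -/
def IsMaximal {E : HolElement} (Q : RegularContinuation.{u} E) : Prop :=
  ∀ Q' : RegularContinuation.{u} E, ∃ φ : Q'.S → Q.S,
    MDifferentiable 𝓘(ℂ) 𝓘(ℂ) φ ∧ (∀ s, Q.proj (φ s) = Q'.proj s) ∧
      (∀ z, φ (Q'.incl z) = Q.incl z) ∧ (∀ s, Q.F (φ s) = Q'.F s)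

/-- The projection of `Q` is a topological covering of its image. -/
def IsCovering {E : HolElement} (Q : RegularContinuation.{u} E) : Prop :=
  IsCoveringMap (Set.rangeFactorization Q.proj)

end RegularContinuation

open Metric Set Filter

/-! ### Products of reals in `(0, 1]` -/

/-! The zeros of `B` accumulate at every point of the circle while `B` is not identically zero, so
by the identity theorem `B` has no holomorphic extension to a neighbourhood of any boundary point
(`not_eqOn_ball_of_norm_eq_one`). This gives the natural boundary, and it also confines the inverse:
a branch `g` of the inverse on a connected open set stays in the disc
(`inverseBranch_of_isPreconnected`). Indeed, if `g` reached the circle at a point where `g' ≠ 0`,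
its local inverse would extend `B` across that point; the zeros of `g'` do not disconnect the
domain, and the maximum principle handles them.

The Schwarz lemma then bounds the radii (`radius_le`). Let `g` be a branch on `|w| < ρ` with `g 0 =
a m`, and let `b k` be the Blaschke factor at `a k`. Schwarz gives `|b m (g w)| ≤ |w| / ρ`, whereas
`|w| = |B (g w)| ≤ |b m (g w)| |b n (g w)|`. Hence `ρ ≤ |b n (g w)|`, and `w → 0` yields `ρ ≤ |b n
(a m)|`, which is small when `a m` and `a n` form a close pair.

The set of points of the disc where `B' ≠ 0` is connected, which makes all branches connectable.
With `B` as projection and the inclusion as `F`, it is the maximal continuation: on any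
continuation, `F` takes values in it and `B ∘ F` is the projection (`continuation_mem`). A covering
would provide, on one fixed disc about `0`, branches through all the `a (2 * k)`; their radii tend
to `0`, a contradiction. -/

/-- Summability of `1 - x n` makes the logarithms summable, and the exponential of their sum bounds
all finite products from below at once. This uniform bound is what keeps limits of partial products
away from zero. -/
theorem exists_pos_le_finset_prod {ι : Type*} {x : ι → ℝ} (h0 : ∀ n, 0 < x n) (h1 : ∀ n, x n ≤ 1)
    (hs : Summable fun n => 1 - x n) : ∃ δ > 0, ∀ s : Finset ι, δ ≤ ∏ n ∈ s, x n := by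
  have hlog : Summable fun n => -Real.log (x n) := by
    have := Real.summable_log_one_add_of_summable (f := fun n => x n - 1)
      (by simpa using hs.neg)
    simpa using this.neg
  refine ⟨Real.exp (-∑' n, -Real.log (x n)), Real.exp_pos _, fun s => ?_⟩
  have h := hlog.sum_le_tsum s fun n _ => neg_nonneg.2 (Real.log_nonpos (h0 n).le (h1 n))
  calc Real.exp (-∑' n, -Real.log (x n)) ≤ Real.exp (∑ n ∈ s, Real.log (x n)) := by
        rw [Finset.sum_neg_distrib] at h
        exact Real.exp_le_exp.2 (by linarith)
    _ = ∏ n ∈ s, x n := by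
        rw [Real.exp_sum]
        exact Finset.prod_congr rfl fun n _ => Real.exp_log (h0 n)

/-! ### Blaschke factors -/

/-- The disc automorphism `z ↦ (z - a) / (1 - conj a * z)`. -/
noncomputable def blaschkeFactor (a z : ℂ) : ℂ := (z - a) / (1 - (starRingEnd ℂ) a * z)

section BlaschkeFactor

variable {a z : ℂ}

theorem one_sub_norm_le_norm_one_sub_conj_mul (ha : ‖a‖ ≤ 1) :
    1 - ‖z‖ ≤ ‖1 - (starRingEnd ℂ) a * z‖ := by
  have h1 : ‖(starRingEnd ℂ) a * z‖ ≤ ‖z‖ := by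
    rw [norm_mul, RCLike.norm_conj]
    exact mul_le_of_le_one_left (norm_nonneg _) ha
  have h2 := norm_sub_norm_le (1 : ℂ) ((starRingEnd ℂ) a * z)
  rw [norm_one] at h2
  linarith

theorem one_sub_conj_mul_ne_zero (ha : ‖a‖ ≤ 1) (hz : ‖z‖ < 1) :
    1 - (starRingEnd ℂ) a * z ≠ 0 := by
  rw [← norm_pos_iff]
  linarith [one_sub_norm_le_norm_one_sub_conj_mul (z := z) ha]

theorem normSq_one_sub_conj_mul_sub_normSq_sub (a z : ℂ) :
    ‖1 - (starRingEnd ℂ) a * z‖ ^ 2 - ‖z - a‖ ^ 2 = (1 - ‖a‖ ^ 2) * (1 - ‖z‖ ^ 2) := by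
  simp only [← Complex.normSq_eq_norm_sq, Complex.normSq_apply]
  simp
  ring

theorem one_sub_normSq_blaschkeFactor (ha : ‖a‖ ≤ 1) (hz : ‖z‖ < 1) :
    1 - ‖blaschkeFactor a z‖ ^ 2 =
      (1 - ‖a‖ ^ 2) * (1 - ‖z‖ ^ 2) / ‖1 - (starRingEnd ℂ) a * z‖ ^ 2 := by
  have h := norm_ne_zero_iff.2 (one_sub_conj_mul_ne_zero ha hz)
  rw [blaschkeFactor, norm_div, ← normSq_one_sub_conj_mul_sub_normSq_sub, div_pow, sub_div,
    div_self (pow_ne_zero 2 h)]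

theorem norm_blaschkeFactor_lt_one (ha : ‖a‖ < 1) (hz : ‖z‖ < 1) : ‖blaschkeFactor a z‖ < 1 := by
  have h := norm_pos_iff.2 (one_sub_conj_mul_ne_zero ha.le hz)
  have h1 : 0 < 1 - ‖blaschkeFactor a z‖ ^ 2 := by
    rw [one_sub_normSq_blaschkeFactor ha.le hz]
    have := norm_nonneg a
    have := norm_nonneg z
    exact div_pos (mul_pos (by nlinarith) (by nlinarith)) (by positivity)
  nlinarith [norm_nonneg (blaschkeFactor a z)]

/-- Under the Blaschke condition this makes the defects of the factors summable at a fixed `z`. -/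
theorem one_sub_norm_blaschkeFactor_le (ha : ‖a‖ < 1) (hz : ‖z‖ < 1) :
    1 - ‖blaschkeFactor a z‖ ≤ 2 / (1 - ‖z‖) ^ 2 * (1 - ‖a‖) := by
  have h := one_sub_norm_le_norm_one_sub_conj_mul (z := z) ha.le
  have hz' : 0 < 1 - ‖z‖ := by linarith
  have h1 := norm_blaschkeFactor_lt_one ha hz
  calc 1 - ‖blaschkeFactor a z‖ ≤ 1 - ‖blaschkeFactor a z‖ ^ 2 := by
        nlinarith [norm_nonneg (blaschkeFactor a z)]
    _ = (1 - ‖a‖ ^ 2) * (1 - ‖z‖ ^ 2) / ‖1 - (starRingEnd ℂ) a * z‖ ^ 2 :=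
        one_sub_normSq_blaschkeFactor ha.le hz
    _ ≤ (2 * (1 - ‖a‖)) / (1 - ‖z‖) ^ 2 := by
        have := norm_nonneg a
        have := norm_nonneg z
        have h2 : (1 - ‖a‖ ^ 2) * (1 - ‖z‖ ^ 2) ≤ 2 * (1 - ‖a‖) := by
          have : (1 - ‖a‖ ^ 2) ≤ 2 * (1 - ‖a‖) := by nlinarith
          have : 0 ≤ 1 - ‖a‖ ^ 2 := by nlinarith
          nlinarith [sq_nonneg ‖z‖]
        gcongr
    _ = 2 / (1 - ‖z‖) ^ 2 * (1 - ‖a‖) := by ring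

theorem blaschkeFactor_self (a : ℂ) : blaschkeFactor a a = 0 := by simp [blaschkeFactor]

theorem blaschkeFactor_eq_zero_iff (ha : ‖a‖ ≤ 1) (hz : ‖z‖ < 1) :
    blaschkeFactor a z = 0 ↔ z = a := by
  simp [blaschkeFactor, div_eq_zero_iff, one_sub_conj_mul_ne_zero ha hz, sub_eq_zero]

theorem differentiableOn_blaschkeFactor (ha : ‖a‖ ≤ 1) :
    DifferentiableOn ℂ (blaschkeFactor a) (ball 0 1) := by
  refine DifferentiableOn.div (by fun_prop) (by fun_prop) fun z hz => ?_
  exact one_sub_conj_mul_ne_zero ha (by simpa using hz)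

/-- With the customary constant the difference to `1` acquires the explicit factor `1 - ‖a‖`; this
is the majorant in the Weierstrass test. -/
theorem norm_one_sub_blaschkeConst_mul_blaschkeFactor_le (ha : ‖a‖ < 1) (hz : ‖z‖ < 1) :
    ‖blaschkeConst a * blaschkeFactor a z - 1‖ ≤ 2 / (1 - ‖z‖) * (1 - ‖a‖) := by
  have hz' : 0 < 1 - ‖z‖ := by linarith
  by_cases h0 : a = 0
  · subst h0
    have : ‖z - 1‖ ≤ 2 := (norm_sub_le _ _).trans (by simp; linarith)
    simp only [blaschkeConst, if_true, blaschkeFactor, map_zero, zero_mul, sub_zero, div_one,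
      one_mul, norm_zero, mul_one]
    exact this.trans ((le_div_iff₀ hz').2 (by nlinarith [norm_nonneg z]))
  have hd := one_sub_conj_mul_ne_zero ha.le hz
  have hn : (starRingEnd ℂ) a * a = (‖a‖ : ℂ) ^ 2 := by
    rw [mul_comm, Complex.mul_conj, Complex.normSq_eq_norm_sq]; push_cast; ring
  have key : blaschkeConst a * blaschkeFactor a z - 1 =
      -((1 - (‖a‖ : ℂ)) * (a + ‖a‖ * z) / (a * (1 - (starRingEnd ℂ) a * z))) := by
    rw [blaschkeConst, if_neg h0, blaschkeFactor]
    generalize hw : 1 - (starRingEnd ℂ) a * z = w at hd ⊢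
    field_simp
    linear_combination a * hw + z * hn
  have h1 : ‖(1 - (‖a‖ : ℂ))‖ = 1 - ‖a‖ := by
    rw [← Complex.ofReal_one, ← Complex.ofReal_sub, Complex.norm_real,
      Real.norm_of_nonneg (by linarith)]
  have h2 : ‖a + ‖a‖ * z‖ ≤ ‖a‖ * 2 := by
    refine (norm_add_le _ _).trans ?_
    rw [norm_mul, Complex.norm_real, norm_norm]
    nlinarith [norm_nonneg a]
  have h3 := one_sub_norm_le_norm_one_sub_conj_mul (z := z) ha.le
  have h4 := norm_pos_iff.2 h0
  rw [key, norm_neg, norm_div, norm_mul, norm_mul, h1]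
  calc (1 - ‖a‖) * ‖a + ‖a‖ * z‖ / (‖a‖ * ‖1 - (starRingEnd ℂ) a * z‖)
      ≤ (1 - ‖a‖) * (‖a‖ * 2) / (‖a‖ * (1 - ‖z‖)) := by
        have : 0 ≤ 1 - ‖a‖ := by linarith
        gcongr
    _ = 2 / (1 - ‖z‖) * (1 - ‖a‖) := by field_simp

theorem norm_blaschkeFactor_le_div {b : ℂ} (ha : ‖a‖ < 1) (hb : ‖b‖ ≤ 1) :
    ‖blaschkeFactor b a‖ ≤ ‖a - b‖ / (1 - ‖a‖) := by
  rw [blaschkeFactor, norm_div]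
  have : 0 < 1 - ‖a‖ := by linarith
  gcongr
  exact one_sub_norm_le_norm_one_sub_conj_mul hb

end BlaschkeFactor

theorem blaschkePartialProduct_eq (a c : ℕ → ℂ) (N : ℕ) (z : ℂ) :
    blaschkePartialProduct a c N z = ∏ n ∈ Finset.range N, c n * blaschkeFactor (a n) z := rfl

/-! ### Existence of paired Blaschke sequences -/

/-- The distances to the unit circle in the construction of a paired Blaschke sequence. -/
noncomputable def pairedGap (m : ℕ) : ℝ :=
  (1 / 2) ^ (m / 2 + 1) - if Even m then 0 else ((1 / 2) ^ (m / 2 + 1)) ^ 2 / 2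

theorem pairedGap_even (n : ℕ) : pairedGap (2 * n) = (1 / 2) ^ (n + 1) := by
  simp [pairedGap]

theorem pairedGap_odd (n : ℕ) :
    pairedGap (2 * n + 1) = (1 / 2) ^ (n + 1) - ((1 / 2) ^ (n + 1)) ^ 2 / 2 := by
  have h : (2 * n + 1) / 2 = n := by omega
  have h' : ¬ Even (2 * n + 1) := by simp
  rw [pairedGap, h, if_neg h']

theorem half_pow_succ_mem (n : ℕ) : (0 : ℝ) < (1 / 2) ^ (n + 1) ∧ (1 / 2 : ℝ) ^ (n + 1) ≤ 1 / 2 := by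
  refine ⟨by positivity, ?_⟩
  rw [pow_succ]
  have : (1 / 2 : ℝ) ^ n ≤ 1 := pow_le_one₀ (by norm_num) (by norm_num)
  linarith

/-- Makes the moduli of the constructed points distinct, hence the points themselves. -/
theorem strictAnti_pairedGap : StrictAnti pairedGap := by
  refine strictAnti_nat_of_succ_lt fun m => ?_
  rcases Nat.even_or_odd' m with ⟨n, rfl | rfl⟩ <;> have h := half_pow_succ_mem n
  · rw [pairedGap_odd, pairedGap_even]
    nlinarith
  · rw [show 2 * n + 1 + 1 = 2 * (n + 1) by ring, pairedGap_odd, pairedGap_even, pow_succ _ (n + 1)]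
    nlinarith

theorem pairedGap_mem (m : ℕ) : 0 < pairedGap m ∧ pairedGap m ≤ 1 / 2 := by
  rcases Nat.even_or_odd' m with ⟨n, rfl | rfl⟩ <;> have h := half_pow_succ_mem n
  · rwa [pairedGap_even]
  · rw [pairedGap_odd]
    constructor <;> nlinarith

theorem summable_pairedGap : Summable pairedGap := by
  have hg : Summable fun n : ℕ => (1 / 2 : ℝ) ^ (n + 1) :=
    (summable_nat_add_iff 1).2 (summable_geometric_of_lt_one (by norm_num) (by norm_num))
  refine (HasSum.even_add_odd (f := pairedGap) (m := ∑' n, pairedGap (2 * n))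
    (m' := ∑' n, pairedGap (2 * n + 1)) (Summable.hasSum ?_) (Summable.hasSum ?_)).summable
  · simpa only [pairedGap_even] using hg
  · refine Summable.of_nonneg_of_le (fun n => (pairedGap_mem _).1.le) (fun n => ?_) hg
    rw [pairedGap_odd]
    nlinarith [half_pow_succ_mem n]

theorem exists_isPairedBlaschkeSequence : ∃ a : ℕ → ℂ, IsPairedBlaschkeSequence a := by
  have : Nonempty (sphere (0 : ℂ) 1) := ⟨⟨1, by simp⟩⟩
  -- The first component of `Nat.unpair` repeats every term of the dense sequence at arbitrarily
  -- large indices. The points `2 * n` and `2 * n + 1` lie on the same ray through `u n`.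
  let u : ℕ → ℂ := fun n => TopologicalSpace.denseSeq (sphere (0 : ℂ) 1) (Nat.unpair n).1
  have hu : ∀ n, ‖u n‖ = 1 := fun n =>
    mem_sphere_zero_iff_norm.1 (TopologicalSpace.denseSeq (sphere (0 : ℂ) 1) (Nat.unpair n).1).2
  let a : ℕ → ℂ := fun m => ((1 - pairedGap m : ℝ) : ℂ) * u (m / 2)
  have hna : ∀ m, ‖a m‖ = 1 - pairedGap m := fun m => by
    simp only [a]
    rw [norm_mul, hu, mul_one, Complex.norm_real,
      Real.norm_of_nonneg (by linarith [pairedGap_mem m])]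
  refine ⟨a, ⟨fun n => ?_, fun m n h => ?_, ?_, fun p hp => ?_, fun n => ?_⟩⟩
  · simpa [hna] using (pairedGap_mem n).1
  · refine strictAnti_pairedGap.injective ?_
    have := congrArg norm h
    rw [hna, hna] at this
    linarith
  · simpa [hna] using summable_pairedGap
  · rw [mapClusterPt_iff_frequently]
    intro s hs
    obtain ⟨ε, hε, hεs⟩ := Metric.mem_nhds_iff.1 hs
    rw [frequently_atTop]
    intro N
    have hlim : Tendsto pairedGap atTop (𝓝 0) := summable_pairedGap.tendsto_atTop_zero
    obtain ⟨M, hM⟩ := eventually_atTop.1 (hlim.eventually (gt_mem_nhds (half_pos hε)))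
    obtain ⟨k, hk⟩ := (TopologicalSpace.denseRange_denseSeq (sphere (0 : ℂ) 1)).exists_dist_lt
      ⟨p, hp⟩ (half_pos hε)
    set n := Nat.pair k (max M N)
    have hn : max M N ≤ n := Nat.right_le_pair _ _
    have hM' := le_max_left M N
    have hN' := le_max_right M N
    refine ⟨2 * n, by omega, hεs ?_⟩
    have hun : u n = TopologicalSpace.denseSeq (sphere (0 : ℂ) 1) k := by simp [u, n]
    have h1 : dist (a (2 * n)) (u n) = pairedGap (2 * n) := by
      have : a (2 * n) - u n = -((pairedGap (2 * n) : ℝ) : ℂ) * u n := by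
        simp only [a, Nat.mul_div_cancel_left n two_pos]; push_cast; ring
      rw [dist_eq_norm, this, norm_mul, hu, norm_neg, mul_one, Complex.norm_real,
        Real.norm_of_nonneg (pairedGap_mem _).1.le]
    have h2 : dist (u n) p < ε / 2 := by rw [hun, dist_comm]; exact hk
    have h3 := hM (2 * n) (by omega)
    exact mem_ball.2 ((dist_triangle _ (u n) _).trans_lt (by rw [h1]; linarith))
  · have : a (2 * n) - a (2 * n + 1) =
        ((pairedGap (2 * n + 1) - pairedGap (2 * n) : ℝ) : ℂ) * u n := by
      have h : (2 * n + 1) / 2 = n := by omega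
      simp only [a, Nat.mul_div_cancel_left n two_pos, h]; push_cast; ring
    rw [this, norm_mul, hu, hna, mul_one, Complex.norm_real, pairedGap_odd, pairedGap_even,
      Real.norm_eq_abs, abs_le]
    constructor <;> nlinarith [half_pow_succ_mem n]

/-! ### Blaschke products -/

namespace IsPairedBlaschkeSequence

variable {a : ℕ → ℂ}

theorem norm_lt_one (ha : IsPairedBlaschkeSequence a) (n : ℕ) : ‖a n‖ < 1 := by
  simpa using ha.mem_disc n

theorem exists_isBlaschkeProduct (ha : IsPairedBlaschkeSequence a) :
    ∃ B : ℂ → ℂ, IsBlaschkeProduct a (fun n => blaschkeConst (a n)) B := by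
  let f : ℕ → ℂ → ℂ := fun n z => blaschkeConst (a n) * blaschkeFactor (a n) z - 1
  have hprod : HasProdLocallyUniformlyOn (fun n z => 1 + f n z) (fun z => ∏' n, (1 + f n z))
      (ball 0 1) := by
    refine hasProdLocallyUniformlyOn_of_forall_compact isOpen_ball fun K hK hKc => ?_
    obtain ⟨r, hr, hKr⟩ : ∃ r < (1 : ℝ), ∀ z ∈ K, ‖z‖ ≤ r := by
      rcases K.eq_empty_or_nonempty with rfl | hne
      · exact ⟨0, by simp, by simp⟩
      · obtain ⟨z, hz, hmax⟩ := hKc.exists_isMaxOn hne continuous_norm.continuousOn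
        exact ⟨‖z‖, by simpa using hK hz, hmax⟩
    refine Summable.hasProdUniformlyOn_nat_one_add hKc
      (ha.summable.mul_left (2 / (1 - r))) (Eventually.of_forall fun n z hz => ?_) fun n => ?_
    · have hzr := hKr z hz
      have h1 : 0 ≤ 1 - ‖a n‖ := by linarith [ha.norm_lt_one n]
      refine (norm_one_sub_blaschkeConst_mul_blaschkeFactor_le (ha.norm_lt_one n)
        (hzr.trans_lt hr)).trans ?_
      have : 0 < 1 - r := by linarith
      gcongr
    · exact (((differentiableOn_blaschkeFactor (ha.norm_lt_one n).le).continuousOn.mono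
        hK).const_mul _).sub continuousOn_const
  refine ⟨fun z => ∏' n, (1 + f n z), fun n => ?_, ?_⟩
  · by_cases h : a n = 0 <;> simp [blaschkeConst, h]
  · refine hprod.tendstoLocallyUniformlyOn_finsetRange.congr fun N z _ => ?_
    simp [f, blaschkePartialProduct_eq]

theorem exists_pos_le_prod_norm_blaschkeFactor (ha : IsPairedBlaschkeSequence a) {z : ℂ}
    (hz : ‖z‖ < 1) :
    ∃ δ > 0, ∀ s : Finset ℕ, (∀ n ∈ s, a n ≠ z) → δ ≤ ∏ n ∈ s, ‖blaschkeFactor (a n) z‖ := by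
  classical
  have hle : ∀ n, ‖blaschkeFactor (a n) z‖ ≤ 1 := fun n =>
    (norm_blaschkeFactor_lt_one (ha.norm_lt_one n) hz).le
  -- A factor vanishing at `z` is replaced by `1`, so that the bound serves both points off the zero
  -- set and the remaining factors at a zero.
  let x : ℕ → ℝ := fun n => if a n = z then 1 else ‖blaschkeFactor (a n) z‖
  have hx0 : ∀ n, 0 < x n := fun n => by
    simp only [x]
    split_ifs with hn
    · exact one_pos
    · rw [norm_pos_iff, Ne, blaschkeFactor_eq_zero_iff (ha.norm_lt_one n).le hz]
      exact fun h => hn h.symm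
  have hx1 : ∀ n, x n ≤ 1 := fun n => by
    simp only [x]
    split_ifs
    exacts [le_rfl, hle n]
  have hxs : Summable fun n => 1 - x n := by
    refine Summable.of_nonneg_of_le (fun n => sub_nonneg.2 (hx1 n)) (fun n => ?_)
      (ha.summable.mul_left (2 / (1 - ‖z‖) ^ 2))
    have := one_sub_norm_blaschkeFactor_le (ha.norm_lt_one n) hz
    simp only [x]
    split_ifs
    exacts [by linarith [hle n], this]
  obtain ⟨δ, hδ, h⟩ := exists_pos_le_finset_prod hx0 hx1 hxs
  refine ⟨δ, hδ, fun s hs => (h s).trans_eq (Finset.prod_congr rfl fun n hn => ?_)⟩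
  exact if_neg (hs n hn)

theorem pair_div_le (ha : IsPairedBlaschkeSequence a) (n : ℕ) :
    ‖a (2 * n) - a (2 * n + 1)‖ / (1 - ‖a (2 * n)‖) ≤ 1 - ‖a (2 * n)‖ := by
  have h : 0 < 1 - ‖a (2 * n)‖ := by linarith [ha.norm_lt_one (2 * n)]
  rw [div_le_iff₀ h, ← sq]
  exact ha.close n

theorem tendsto_one_sub_norm_even (ha : IsPairedBlaschkeSequence a) :
    Tendsto (fun n => 1 - ‖a (2 * n)‖) atTop (𝓝 0) :=
  ha.summable.tendsto_atTop_zero.comp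
    (tendsto_id.const_mul_atTop' (by norm_num : (0 : ℕ) < 2))

end IsPairedBlaschkeSequence

namespace IsBlaschkeProduct

variable {a c : ℕ → ℂ} {B : ℂ → ℂ}

theorem norm_partialProduct (hB : IsBlaschkeProduct a c B) (N : ℕ) (z : ℂ) :
    ‖blaschkePartialProduct a c N z‖ = ∏ n ∈ Finset.range N, ‖blaschkeFactor (a n) z‖ := by
  simp [blaschkePartialProduct_eq, norm_prod, hB.1]

theorem tendsto_norm (hB : IsBlaschkeProduct a c B) {z : ℂ} (hz : z ∈ ball (0 : ℂ) 1) :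
    Tendsto (fun N => ∏ n ∈ Finset.range N, ‖blaschkeFactor (a n) z‖) atTop (𝓝 ‖B z‖) := by
  simpa only [hB.norm_partialProduct] using (hB.2.tendsto_at hz).norm

theorem differentiableOn_partialProduct (ha : IsPairedBlaschkeSequence a) (N : ℕ) :
    DifferentiableOn ℂ (blaschkePartialProduct a c N) (ball 0 1) := by
  refine DifferentiableOn.fun_finsetProd fun n _ => ?_
  exact (differentiableOn_blaschkeFactor (ha.norm_lt_one n).le).const_mul (c n)

theorem differentiableOn (hB : IsBlaschkeProduct a c B) (ha : IsPairedBlaschkeSequence a) :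
    DifferentiableOn ℂ B (ball 0 1) :=
  hB.2.differentiableOn (Eventually.of_forall (differentiableOn_partialProduct ha)) isOpen_ball

theorem analyticAt (hB : IsBlaschkeProduct a c B) (ha : IsPairedBlaschkeSequence a) {z : ℂ}
    (hz : z ∈ ball (0 : ℂ) 1) : AnalyticAt ℂ B z :=
  (hB.differentiableOn ha).analyticAt (isOpen_ball.mem_nhds hz)

/-- All factors have modulus at most `1`, so dropping factors from a partial product only increases
its modulus; this avoids factoring `B` itself. -/
theorem norm_le_prod (hB : IsBlaschkeProduct a c B) (ha : IsPairedBlaschkeSequence a) {z : ℂ}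
    (hz : z ∈ ball (0 : ℂ) 1) (s : Finset ℕ) :
    ‖B z‖ ≤ ∏ n ∈ s, ‖blaschkeFactor (a n) z‖ := by
  refine le_of_tendsto (hB.tendsto_norm hz) ?_
  obtain ⟨M, hM⟩ := s.exists_nat_subset_range
  filter_upwards [eventually_ge_atTop M] with N hN
  refine Finset.prod_le_prod_of_subset_of_le_one (hM.trans (Finset.range_mono hN))
    (fun n _ => norm_nonneg _) fun n _ _ => ?_
  exact (norm_blaschkeFactor_lt_one (ha.norm_lt_one n) (by simpa using hz)).le

theorem apply_eq_zero (hB : IsBlaschkeProduct a c B) (ha : IsPairedBlaschkeSequence a) (n : ℕ) :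
    B (a n) = 0 := by
  have h := hB.norm_le_prod ha (ha.mem_disc n) {n}
  simpa [blaschkeFactor_self] using h

theorem norm_le_mul (hB : IsBlaschkeProduct a c B) (ha : IsPairedBlaschkeSequence a) {z : ℂ}
    (hz : z ∈ ball (0 : ℂ) 1) {m n : ℕ} (hmn : m ≠ n) :
    ‖B z‖ ≤ ‖blaschkeFactor (a m) z‖ * ‖blaschkeFactor (a n) z‖ := by
  simpa [Finset.prod_pair hmn] using hB.norm_le_prod ha hz {m, n}

theorem mapsTo (hB : IsBlaschkeProduct a c B) (ha : IsPairedBlaschkeSequence a) :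
    MapsTo B (ball 0 1) (ball 0 1) := by
  intro z hz
  have h := hB.norm_le_prod ha hz {0}
  rw [mem_ball_zero_iff]
  simp only [Finset.prod_singleton] at h
  exact h.trans_lt (norm_blaschkeFactor_lt_one (ha.norm_lt_one 0) (by simpa using hz))

theorem apply_eq_zero_iff (hB : IsBlaschkeProduct a c B) (ha : IsPairedBlaschkeSequence a) {z : ℂ}
    (hz : z ∈ ball (0 : ℂ) 1) : B z = 0 ↔ ∃ n, a n = z := by
  refine ⟨fun h => ?_, ?_⟩
  · by_contra! hne
    obtain ⟨δ, hδ, hδ'⟩ := ha.exists_pos_le_prod_norm_blaschkeFactor (z := z) (by simpa using hz)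
    have := ge_of_tendsto' (hB.tendsto_norm hz) fun N => hδ' _ fun n _ => hne n
    rw [h, norm_zero] at this
    linarith
  · rintro ⟨n, rfl⟩
    exact hB.apply_eq_zero ha n

/-- Locally uniform convergence passes to derivatives. For the partial products, the derivative at
`a n` is the cofactor of `z - a n`, whose modulus stays above a fixed `δ`. -/
theorem deriv_ne_zero (hB : IsBlaschkeProduct a c B) (ha : IsPairedBlaschkeSequence a) (n : ℕ) :
    deriv B (a n) ≠ 0 := by
  have hn := ha.mem_disc n
  have hn1 := ha.norm_lt_one n
  have hlim : Tendsto (fun N => deriv (blaschkePartialProduct a c N) (a n)) atTop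
      (𝓝 (deriv B (a n))) :=
    (hB.2.deriv (Eventually.of_forall (differentiableOn_partialProduct ha))
      isOpen_ball).tendsto_at hn
  obtain ⟨δ, hδ, hδ'⟩ := ha.exists_pos_le_prod_norm_blaschkeFactor hn1
  have hbound : ∀ N > n, δ ≤ ‖deriv (blaschkePartialProduct a c N) (a n)‖ := by
    intro N hN
    have hmem : n ∈ Finset.range N := Finset.mem_range.2 hN
    let R : ℂ → ℂ := fun z => c n / (1 - (starRingEnd ℂ) (a n) * z) *
      ∏ k ∈ (Finset.range N).erase n, c k * blaschkeFactor (a k) z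
    have hR : DifferentiableAt ℂ R (a n) := by
      refine DifferentiableAt.mul ?_ ?_
      · exact DifferentiableAt.div (by fun_prop) (by fun_prop) (one_sub_conj_mul_ne_zero hn1.le hn1)
      · refine DifferentiableAt.fun_finsetProd fun k _ => ?_
        exact ((differentiableOn_blaschkeFactor (ha.norm_lt_one k).le).differentiableAt
          (isOpen_ball.mem_nhds hn)).const_mul (c k)
    have hP : blaschkePartialProduct a c N = fun z => (z - a n) * R z := by
      ext z
      rw [blaschkePartialProduct_eq, ← Finset.mul_prod_erase _ _ hmem, blaschkeFactor]
      ring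
    have hd : HasDerivAt (blaschkePartialProduct a c N) (R (a n)) (a n) := by
      rw [hP]
      have h := ((hasDerivAt_id (a n)).sub_const (a n)).mul hR.hasDerivAt
      rwa [id, sub_self, zero_mul, add_zero, one_mul] at h
    have h1 : ‖1 - (starRingEnd ℂ) (a n) * a n‖ ≤ 1 := by
      rw [mul_comm, Complex.mul_conj, Complex.normSq_eq_norm_sq, ← Complex.ofReal_one,
        ← Complex.ofReal_sub, Complex.norm_real, Real.norm_of_nonneg]
      · nlinarith [norm_nonneg (a n)]
      · nlinarith [norm_nonneg (a n)]
    have h2 := hδ' ((Finset.range N).erase n) fun k hk h =>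
      (Finset.mem_erase.1 hk).1 (ha.injective h)
    rw [hd.deriv]
    simp only [R, norm_mul, norm_prod, norm_div, hB.1, one_mul]
    refine h2.trans (le_mul_of_one_le_left (by positivity) ?_)
    exact (one_le_div (norm_pos_iff.2 (one_sub_conj_mul_ne_zero hn1.le hn1))).2 h1
  intro h0
  have h := ge_of_tendsto hlim.norm ((eventually_gt_atTop n).mono hbound)
  rw [h0, norm_zero] at h
  linarith

end IsBlaschkeProduct

/-! ### Holomorphic functions of one variable -/

/-- Polar coordinates exhibit the punctured disc as a continuous image of a convex strip. -/
theorem Complex.isPreconnected_ball_diff_singleton (z : ℂ) (r : ℝ) :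
    IsPreconnected (ball z r \ {z}) := by
  have h : ball z r \ {z} =
      (fun p : ℝ × ℝ => z + p.1 * Complex.exp (p.2 * Complex.I)) '' (Ioo 0 r ×ˢ univ) := by
    ext w
    constructor
    · rintro ⟨hw, hne⟩
      refine ⟨(‖w - z‖, (w - z).arg), ⟨⟨norm_pos_iff.2 (sub_ne_zero.2 hne), ?_⟩, mem_univ _⟩, ?_⟩
      · rwa [← dist_eq_norm]
      · simp
    · rintro ⟨⟨ρ, θ⟩, ⟨⟨h0, h1⟩, -⟩, rfl⟩
      simp only at h0 h1
      refine ⟨by simpa [dist_eq_norm, Complex.norm_exp_ofReal_mul_I, abs_of_pos h0] using h1, ?_⟩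
      simp [h0.ne', Complex.exp_ne_zero]
  rw [h]
  refine ((convex_Ioo 0 r).isPreconnected.prod isPreconnected_univ).image _ ?_
  fun_prop

/-- Zeros are isolated and punctured discs are connected, so a separation of the nonvanishing set
would extend over the zeros to a separation of `U`. -/
theorem DifferentiableOn.isPreconnected_setOf_ne_zero {U : Set ℂ} {h : ℂ → ℂ}
    (hh : DifferentiableOn ℂ h U) (hU : IsOpen U) (hUc : IsPreconnected U) {z₁ : ℂ} (hz₁ : z₁ ∈ U)
    (hne : h z₁ ≠ 0) : IsPreconnected {z ∈ U | h z ≠ 0} := by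
  have han : AnalyticOnNhd ℂ h U := hh.analyticOnNhd hU
  have key : ∀ z ∈ U, ∃ r > 0, ball z r \ {z} ⊆ {z ∈ U | h z ≠ 0} := by
    intro z hz
    rcases (han z hz).eventually_eq_zero_or_eventually_ne_zero with h0 | h0
    · exact absurd (han.eqOn_zero_of_preconnected_of_eventuallyEq_zero hUc hz h0 hz₁) hne
    · have h1 : ∀ᶠ w in 𝓝[≠] z, w ∈ U ∧ h w ≠ 0 :=
        Filter.Eventually.and (mem_nhdsWithin_of_mem_nhds (hU.mem_nhds hz)) h0
      obtain ⟨r, hr, hsub⟩ := Metric.mem_nhdsWithin_iff.1 h1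
      exact ⟨r, hr, hsub⟩
  rw [isPreconnected_iff_subset_of_disjoint]
  intro u v hu hv hcov hdisj
  set C := {z ∈ U | h z ≠ 0}
  -- Each point of `U` is assigned to the piece containing a punctured neighbourhood of it.
  have hcov' : U ⊆ {z | ∀ᶠ w in 𝓝[≠] z, w ∈ C ∩ u} ∪ {z | ∀ᶠ w in 𝓝[≠] z, w ∈ C ∩ v} := by
    intro z hz
    obtain ⟨r, hr, hsub⟩ := key z hz
    have hmem : ball z r \ {z} ∈ 𝓝[≠] z :=
      Metric.mem_nhdsWithin_iff.2 ⟨r, hr, fun w hw => ⟨hw.1, hw.2⟩⟩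
    rcases isPreconnected_iff_subset_of_disjoint.1 (Complex.isPreconnected_ball_diff_singleton z r)
      u v hu hv (hsub.trans hcov)
      (subset_empty_iff.1 (hdisj ▸ inter_subset_inter_left _ hsub)) with h' | h'
    · exact Or.inl (mem_of_superset hmem fun w hw => ⟨hsub hw, h' hw⟩)
    · exact Or.inr (mem_of_superset hmem fun w hw => ⟨hsub hw, h' hw⟩)
  have hdis : ∀ z, (∀ᶠ w in 𝓝[≠] z, w ∈ C ∩ u) → ¬ ∀ᶠ w in 𝓝[≠] z, w ∈ C ∩ v := by
    intro z h1 h2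
    obtain ⟨w, hw1, hw2⟩ := (h1.and h2).exists
    exact (hdisj ▸ ⟨hw1.1, hw1.2, hw2.2⟩ : w ∈ (∅ : Set ℂ))
  have hcl : ∀ z ∈ C, ∀ s : Set ℂ, IsOpen s → z ∈ s → ∀ᶠ w in 𝓝[≠] z, w ∈ C ∩ s := by
    intro z hz s hs hzs
    have hC : IsOpen C := han.continuousOn.isOpen_inter_preimage hU isOpen_compl_singleton
    exact mem_nhdsWithin_of_mem_nhds ((hC.inter hs).mem_nhds ⟨hz, hzs⟩)
  rcases isPreconnected_iff_subset_of_disjoint.1 hUc _ _ isOpen_setOfPred_eventually_nhdsWithin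
    isOpen_setOfPred_eventually_nhdsWithin hcov' (eq_empty_of_forall_notMem fun z hz =>
      hdis z hz.2.1 hz.2.2) with h' | h'
  · refine Or.inl fun z hz => (hcov hz).resolve_right fun hzv => ?_
    exact hdis z (h' hz.1) (hcl z hz v hv hzv)
  · refine Or.inr fun z hz => (hcov hz).resolve_left fun hzu => ?_
    exact hdis z (hcl z hz u hu hzu) (h' hz.1)

theorem DifferentiableOn.exists_openPartialHomeomorph {U : Set ℂ} {f : ℂ → ℂ}
    (hf : DifferentiableOn ℂ f U) (hU : IsOpen U) {z : ℂ} (hz : z ∈ U) (hd : _root_.deriv f z ≠ 0) :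
    ∃ e : OpenPartialHomeomorph ℂ ℂ, z ∈ e.source ∧ e.source ⊆ {w ∈ U | _root_.deriv f w ≠ 0} ∧
      (∀ w, e w = f w) ∧ DifferentiableOn ℂ e.symm e.target := by
  have han : AnalyticAt ℂ f z := hf.analyticAt (hU.mem_nhds hz)
  let e₀ := (han.hasStrictDerivAt.hasStrictFDerivAt_equiv hd).toOpenPartialHomeomorph f
  have hV : IsOpen {w ∈ U | _root_.deriv f w ≠ 0} :=
    (hf.deriv hU).continuousOn.isOpen_inter_preimage hU isOpen_compl_singleton
  let e := e₀.restrOpen _ hV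
  have hes : e.source ⊆ {w ∈ U | _root_.deriv f w ≠ 0} := inter_subset_right
  refine ⟨e, ⟨HasStrictFDerivAt.mem_toOpenPartialHomeomorph_source _, hz, hd⟩, hes,
    fun w => rfl, fun w hw => ?_⟩
  have hw' := hes (e.map_target hw)
  refine (e.hasDerivAt_symm (f' := _root_.deriv f (e.symm w)) hw hw'.2
    ?_).differentiableAt.differentiableWithinAt
  exact (hf.differentiableAt (hU.mem_nhds hw'.1)).hasDerivAt

theorem deriv_ne_zero_of_eventually_comp_eq {B g : ℂ → ℂ} {w : ℂ} (hB : DifferentiableAt ℂ B (g w))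
    (hg : DifferentiableAt ℂ g w) (h : ∀ᶠ x in 𝓝 w, B (g x) = x) :
    deriv B (g w) ≠ 0 ∧ deriv g w ≠ 0 := by
  have h1 : HasDerivAt (fun x => B (g x)) (deriv B (g w) * deriv g w) w :=
    hB.hasDerivAt.comp w hg.hasDerivAt
  have h2 := h1.unique ((hasDerivAt_id w).congr_of_eventuallyEq h)
  exact mul_ne_zero_iff.1 (h2 ▸ one_ne_zero)

namespace HolElement

theorem isPreconnected_dom (E : HolElement) : IsPreconnected (E.dom : Set ℂ) := by
  have := E.simplyConnected
  exact isPreconnected_iff_preconnectedSpace.2 (inferInstanceAs (PreconnectedSpace E.dom))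

end HolElement

/-! ### The unit circle is a natural boundary -/

namespace IsBlaschkeProduct

variable {a c : ℕ → ℂ} {B : ℂ → ℂ}

theorem not_eqOn_ball_of_norm_eq_one (hB : IsBlaschkeProduct a c B)
    (ha : IsPairedBlaschkeSequence a) {p : ℂ} (hp : ‖p‖ = 1) {r : ℝ} (hr : 0 < r) {h : ℂ → ℂ}
    (hh : DifferentiableOn ℂ h (ball p r)) : ¬ EqOn h B (ball p r ∩ ball 0 1) := by
  intro heq
  have hcl := (mapClusterPt_iff_frequently.1 (ha.accumulates p (by simpa using hp)))
  have hfreq : ∃ᶠ z in 𝓝[≠] p, h z = 0 := by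
    rw [frequently_nhdsWithin_iff, frequently_iff]
    intro s hs
    obtain ⟨n, hn⟩ := (hcl _ (inter_mem hs (ball_mem_nhds p hr))).exists
    refine ⟨a n, hn.1, ?_, fun h => ?_⟩
    · rw [heq ⟨hn.2, ha.mem_disc n⟩, hB.apply_eq_zero ha]
    · have := ha.norm_lt_one n
      rw [show a n = p from h, hp] at this
      exact lt_irrefl _ this
  have hzero := (hh.analyticOnNhd isOpen_ball).eqOn_zero_of_preconnected_of_frequently_eq_zero
    (convex_ball p r).isPreconnected (mem_ball_self hr) hfreq
  obtain ⟨n, hn⟩ := (hcl _ (ball_mem_nhds p hr)).exists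
  refine hB.deriv_ne_zero ha n ?_
  have : B =ᶠ[𝓝 (a n)] fun _ => 0 := by
    filter_upwards [(isOpen_ball.inter isOpen_ball).mem_nhds ⟨hn, ha.mem_disc n⟩] with z hz
    rw [← heq hz]
    exact hzero hz.1
  rw [this.deriv_eq, deriv_const]

/-- The points of the disc where the germs of `g` and `B` agree form an open set, relatively closed
in `U`: a limit point on the circle would give an extension of `B` across it. -/
theorem eqOn_of_isPreconnected (hB : IsBlaschkeProduct a c B) (ha : IsPairedBlaschkeSequence a)
    {U : Set ℂ} (hU : IsOpen U) (hUc : IsPreconnected U) {g : ℂ → ℂ} (hg : DifferentiableOn ℂ g U)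
    {z₁ : ℂ} (hz₁ : z₁ ∈ U ∩ ball 0 1) (heq : g =ᶠ[𝓝 z₁] B) :
    U ⊆ ball 0 1 ∧ EqOn g B U := by
  have hmain : U ⊆ {z | z ∈ ball (0 : ℂ) 1 ∧ ∀ᶠ w in 𝓝 z, g w = B w} := by
    refine hUc.subset_of_closure_inter_subset (isOpen_ball.inter isOpen_setOfPred_eventually_nhds)
      ⟨z₁, hz₁.1, hz₁.2, heq⟩ ?_
    rintro z ⟨hzcl, hzU⟩
    obtain ⟨r, hr, hrU⟩ := Metric.isOpen_iff.1 hU z hzU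
    obtain ⟨w, hw, hw1, hw2⟩ := mem_closure_iff.1 hzcl _ isOpen_ball (mem_ball_self hr)
    have hV : EqOn g B (ball z r ∩ ball 0 1) :=
      AnalyticOnNhd.eqOn_of_preconnected_of_eventuallyEq
        (fun x hx => hg.analyticAt (hU.mem_nhds (hrU hx.1)))
        (fun x hx => hB.analyticAt ha hx.2)
        ((convex_ball z r).inter (convex_ball 0 1)).isPreconnected ⟨hw, hw1⟩ hw2
    have hz1 : ‖z‖ ≤ 1 := by
      have : z ∈ closure (ball (0 : ℂ) 1) := closure_mono (fun x hx => hx.1) hzcl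
      simpa using closure_ball_subset_closedBall this
    rcases hz1.lt_or_eq with hlt | heq1
    · have hzb : z ∈ ball (0 : ℂ) 1 := by simpa using hlt
      exact ⟨hzb, mem_of_superset
        ((isOpen_ball.inter isOpen_ball).mem_nhds ⟨mem_ball_self hr, hzb⟩) hV⟩
    · exact absurd hV (hB.not_eqOn_ball_of_norm_eq_one ha heq1 hr (hg.mono hrU))
  exact ⟨fun z hz => (hmain hz).1, fun z hz => (hmain hz).2.self_of_nhds⟩

theorem hasNaturalBoundary (hB : IsBlaschkeProduct a c B) (ha : IsPairedBlaschkeSequence a)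
    {D : HolElement} (hD : (D.dom : Set ℂ) = ball 0 1) (heq : EqOn D.toFun B (ball 0 1)) :
    D.HasNaturalBoundary := by
  intro V W hV hVD hVW
  have hmain : (W.dom : Set ℂ) ⊆ ball 0 1 ∧ EqOn W.toFun B W.dom := by
    refine Relation.ReflTransGen.head_induction_on (motive := fun V _ =>
      ((V.dom : Set ℂ) ⊆ ball 0 1 ∧ EqOn V.toFun B V.dom) →
        (W.dom : Set ℂ) ⊆ ball 0 1 ∧ EqOn W.toFun B W.dom) hVW id ?_ ?_
    · rintro X Y ⟨⟨z, hzX, hzY⟩, hXY⟩ - ih ⟨hX, hXB⟩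
      refine ih (hB.eqOn_of_isPreconnected ha Y.dom.isOpen Y.isPreconnected_dom Y.holo
        ⟨hzY, hX hzX⟩ ?_)
      filter_upwards [(X.dom.isOpen.inter Y.dom.isOpen).mem_nhds ⟨hzX, hzY⟩] with w hw
      rw [← hXY hw, hXB hw.1]
    · have hVb : (V.dom : Set ℂ) ⊆ ball 0 1 := hD ▸ hV
      exact ⟨hVb, fun z hz => (hVD hz).trans (heq (hVb hz))⟩
  exact fun z hz => hD.ge (hmain.1 hz)

/-! ### Branches of the inverse stay in the disc -/

/-- Continuity along the set `g' ≠ 0` first gives the claim there; density then gives `‖g‖ ≤ 1`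
throughout, and the maximum principle makes this strict. -/
theorem inverseBranch_of_isPreconnected (hB : IsBlaschkeProduct a c B)
    (ha : IsPairedBlaschkeSequence a) {W : Set ℂ} (hW : IsOpen W) (hWc : IsPreconnected W)
    {g : ℂ → ℂ} (hg : DifferentiableOn ℂ g W) {w₁ : ℂ} (hw₁ : w₁ ∈ W) (hgw₁ : g w₁ ∈ ball (0 : ℂ) 1)
    (hBg : ∀ᶠ w in 𝓝 w₁, B (g w) = w) {w : ℂ} (hw : w ∈ W) :
    g w ∈ ball (0 : ℂ) 1 ∧ B (g w) = w := by
  have hdiff : ∀ x ∈ W, DifferentiableAt ℂ g x := fun x hx => hg.differentiableAt (hW.mem_nhds hx)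
  have hd₁ : deriv g w₁ ≠ 0 := (deriv_ne_zero_of_eventually_comp_eq
    (hB.analyticAt ha hgw₁).differentiableAt (hdiff w₁ hw₁) hBg).2
  set C := {w ∈ W | deriv g w ≠ 0}
  have hC : IsPreconnected C := (hg.deriv hW).isPreconnected_setOf_ne_zero hW hWc hw₁ hd₁
  set u := {w | w ∈ W ∧ g w ∈ ball (0 : ℂ) 1 ∧ ∀ᶠ w' in 𝓝 w, B (g w') = w'}
  have hu : IsOpen u := by
    have := (hg.continuousOn.isOpen_inter_preimage hW (isOpen_ball (x := (0 : ℂ)) (ε := 1))).inter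
      (isOpen_setOfPred_eventually_nhds (p := fun w' => B (g w') = w'))
    convert this using 1
    ext x
    exact and_assoc.symm
  have hCu : C ⊆ u := by
    refine hC.subset_of_closure_inter_subset hu ⟨w₁, ⟨hw₁, hd₁⟩, hw₁, hgw₁, hBg⟩ ?_
    rintro x ⟨hxcl, hxW, hxd⟩
    have hgx1 : ‖g x‖ ≤ 1 := by
      have h1 : g x ∈ closure (ball (0 : ℂ) 1) :=
        (hdiff x hxW).continuousAt.continuousWithinAt.mem_closure hxcl fun y hy => hy.2.1
      simpa using closure_ball_subset_closedBall h1
    rcases hgx1.lt_or_eq with hlt | heq1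
    · have hgx : g x ∈ ball (0 : ℂ) 1 := by simpa using hlt
      obtain ⟨r, hr, hrW⟩ := Metric.isOpen_iff.1
        (hg.continuousOn.isOpen_inter_preimage hW isOpen_ball) x ⟨hxW, hgx⟩
      obtain ⟨y, hy, hyu⟩ := mem_closure_iff.1 hxcl _ isOpen_ball (mem_ball_self hr)
      have hV : EqOn (fun w => B (g w)) id (ball x r) :=
        AnalyticOnNhd.eqOn_of_preconnected_of_eventuallyEq
          (fun z hz => (hB.analyticAt ha (hrW hz).2).comp
            (hg.analyticAt (hW.mem_nhds (hrW hz).1)))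
          (fun z _ => analyticAt_id) (convex_ball x r).isPreconnected hy hyu.2.2
      exact ⟨hxW, hgx, mem_of_superset (ball_mem_nhds x hr) hV⟩
    -- At a boundary value with `g' ≠ 0`, the local inverse of `g` agrees with `B` near a point `g
    -- y` inside the disc, and so extends `B` across the circle.
    · exfalso
      obtain ⟨e, hxe, hes, heg, hsymm⟩ := hg.exists_openPartialHomeomorph hW hxW hxd
      have hgt : g x ∈ e.target := heg x ▸ e.map_source hxe
      obtain ⟨r, hr, hrt⟩ := Metric.isOpen_iff.1 e.open_target _ hgt
      obtain ⟨y, ⟨hye, hyr⟩, hyu⟩ := mem_closure_iff.1 hxcl (e.source ∩ e ⁻¹' ball (g x) r)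
        (e.isOpen_inter_preimage isOpen_ball)
        ⟨hxe, by rw [mem_preimage, heg]; exact mem_ball_self hr⟩
      rw [mem_preimage, heg] at hyr
      refine hB.not_eqOn_ball_of_norm_eq_one ha heq1 hr (hsymm.mono hrt) ?_
      refine AnalyticOnNhd.eqOn_of_preconnected_of_eventuallyEq
        (fun z hz => hsymm.analyticAt (e.open_target.mem_nhds (hrt hz.1)))
        (fun z hz => hB.analyticAt ha hz.2)
        ((convex_ball _ r).inter (convex_ball 0 1)).isPreconnected ⟨hyr, hyu.2.1⟩ ?_
      have hgy : e.symm (g y) = y := by rw [← heg, e.left_inv hye]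
      have hcont : Tendsto e.symm (𝓝 (g y)) (𝓝 y) := by
        have := (e.continuousAt_symm (hrt hyr)).tendsto
        rwa [hgy] at this
      filter_upwards [hcont.eventually (hu.mem_nhds hyu), e.open_target.mem_nhds (hrt hyr)]
        with z hz hzt
      have h1 := hz.2.2.self_of_nhds
      rw [← heg, e.right_inv hzt] at h1
      exact h1.symm
  have hdense : W ⊆ closure C := by
    intro x hx
    rcases ((hg.deriv hW).analyticAt
        (hW.mem_nhds hx)).eventually_eq_zero_or_eventually_ne_zero with h0 | h0
    · exact absurd (((hg.deriv hW).analyticOnNhd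
        hW).eqOn_zero_of_preconnected_of_eventuallyEq_zero hWc hx h0 hw₁) hd₁
    · rw [mem_closure_iff_frequently]
      refine (Eventually.frequently (f := 𝓝[≠] x) ?_).filter_mono nhdsWithin_le_nhds
      exact Filter.Eventually.and (mem_nhdsWithin_of_mem_nhds (hW.mem_nhds hx)) h0
  have hle : ∀ x ∈ W, ‖g x‖ ≤ 1 := by
    intro x hx
    have h1 : g x ∈ closure (ball (0 : ℂ) 1) :=
      (hdiff x hx).continuousAt.continuousWithinAt.mem_closure (hdense hx)
        fun y hy => (hCu hy).2.1
    simpa using closure_ball_subset_closedBall h1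
  have hmem : g w ∈ ball (0 : ℂ) 1 := by
    rw [mem_ball_zero_iff]
    refine (hle w hw).lt_of_ne fun h1 => ?_
    -- If the value `1` were attained, `‖g‖` would be constantly `1`, contrary to its value at `w₁`.
    have := Complex.norm_eqOn_of_isPreconnected_of_isMaxOn hWc hW hg hw
      (fun x hx => by simpa [h1] using hle x hx) hw₁
    simp only [Function.comp, Function.const, h1] at this
    rw [mem_ball_zero_iff] at hgw₁
    exact hgw₁.ne this
  refine ⟨hmem, ?_⟩
  have hcont : ContinuousAt (fun x => B (g x) - x) w :=
    ((hB.analyticAt ha hmem).continuousAt.comp (hdiff w hw).continuousAt).sub continuousAt_id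
  have h1 : B (g w) - w ∈ closure {(0 : ℂ)} :=
    hcont.continuousWithinAt.mem_closure (hdense hw) fun y hy =>
      sub_eq_zero.2 (hCu hy).2.2.self_of_nhds
  rw [closure_singleton] at h1
  exact sub_eq_zero.1 h1

end IsBlaschkeProduct

/-! ### Function elements -/

namespace HolElement

/-- The function element of a holomorphic function on a nonempty convex open set. -/
def ofConvex (U : TopologicalSpace.Opens ℂ) (hU : Convex ℝ (U : Set ℂ)) (hne : (U : Set ℂ).Nonempty)
    (f : ℂ → ℂ) (hf : DifferentiableOn ℂ f U) : HolElement where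
  dom := U
  simplyConnected := by
    have : ContractibleSpace U := hU.contractibleSpace hne
    infer_instance
  toFun := f
  holo := hf

theorem differentiableAt (E : HolElement) {z : ℂ} (hz : z ∈ E.dom) :
    DifferentiableAt ℂ E.toFun z :=
  E.holo.differentiableAt (E.dom.isOpen.mem_nhds hz)

theorem Linked.symm {E E' : HolElement} (h : Linked E E') : Linked E' E :=
  ⟨inter_comm (E.dom : Set ℂ) _ ▸ h.1, inter_comm (E.dom : Set ℂ) _ ▸ h.2.symm⟩

theorem Connectable.symm {E E' : HolElement} (h : Connectable E E') : Connectable E' E := by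
  have : Std.Symm Linked := ⟨fun _ _ => Linked.symm⟩
  exact Relation.ReflTransGen.stdSymm.symm _ _ h

theorem connectable_of_eventuallyEq {E E' : HolElement} {p : ℂ} (hp : p ∈ E.dom) (hp' : p ∈ E'.dom)
    (h : E.toFun =ᶠ[𝓝 p] E'.toFun) : Connectable E E' := by
  obtain ⟨r, hr, hsub⟩ := Metric.mem_nhds_iff.1
    (inter_mem (inter_mem (E.dom.isOpen.mem_nhds hp) (E'.dom.isOpen.mem_nhds hp')) h)
  let X : HolElement := ofConvex ⟨ball p r, isOpen_ball⟩ (convex_ball p r) ⟨p, mem_ball_self hr⟩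
    E.toFun (E.holo.mono fun z hz => (hsub hz).1.1)
  have h1 : Linked E X := ⟨⟨p, hp, mem_ball_self hr⟩, fun z _ => rfl⟩
  have h2 : Linked X E' := ⟨⟨p, mem_ball_self hr, hp'⟩, fun z hz => (hsub hz.1).2⟩
  exact (Relation.ReflTransGen.single h1).tail h2

/-- `E` represents the branch of the inverse of `B` at `B y` with value `y`. -/
def IsBranchAt (B : ℂ → ℂ) (y : ℂ) (E : HolElement) : Prop :=
  B y ∈ E.dom ∧ E.toFun (B y) = y ∧ ∀ᶠ w in 𝓝 (B y), B (E.toFun w) = w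

theorem IsBranchAt.eventuallyEq_symm {B : ℂ → ℂ} {y : ℂ} {E : HolElement} (hE : IsBranchAt B y E)
    {e : OpenPartialHomeomorph ℂ ℂ} (he : ∀ w, e w = B w) (hy : y ∈ e.source) :
    E.toFun =ᶠ[𝓝 (B y)] e.symm := by
  have hcont : Tendsto E.toFun (𝓝 (B y)) (𝓝 y) := by
    have := (E.differentiableAt hE.1).continuousAt.tendsto
    rwa [hE.2.1] at this
  filter_upwards [hcont.eventually (e.open_source.mem_nhds hy), hE.2.2] with w hw hBw
  rw [← e.left_inv hw, he, hBw]

/-- Near a regular point `x`, one local inverse of `B` on a disc about `B x` is connectable to the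
branches at all nearby points. Connectability is thus locally constant along the connected regular
set. -/
theorem connectable_of_isBranchAt {B : ℂ → ℂ} {U : Set ℂ} (hU : IsOpen U)
    (hB : DifferentiableOn ℂ B U) (hc : IsPreconnected {z ∈ U | deriv B z ≠ 0}) {x y : ℂ}
    (hx : x ∈ U ∧ deriv B x ≠ 0) (hy : y ∈ U ∧ deriv B y ≠ 0) {E E' : HolElement}
    (hE : IsBranchAt B x E) (hE' : IsBranchAt B y E') : Connectable E E' := by
  have key : ∀ x ∈ {z ∈ U | deriv B z ≠ 0}, ∃ X : HolElement, IsBranchAt B x X ∧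
      ∀ᶠ y in 𝓝 x, ∀ E, IsBranchAt B y E → Connectable X E := by
    intro x hx
    obtain ⟨e, hxe, -, heB, hsymm⟩ := hB.exists_openPartialHomeomorph hU hx.1 hx.2
    have hxt : B x ∈ e.target := heB x ▸ e.map_source hxe
    obtain ⟨r, hr, hsub⟩ := Metric.isOpen_iff.1 e.open_target _ hxt
    let X : HolElement := ofConvex ⟨ball (B x) r, isOpen_ball⟩ (convex_ball _ r)
      ⟨_, mem_ball_self hr⟩ e.symm (hsymm.mono hsub)
    refine ⟨X, ⟨mem_ball_self hr, ?_, ?_⟩, ?_⟩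
    · change e.symm (B x) = x
      rw [← heB, e.left_inv hxe]
    · filter_upwards [e.open_target.mem_nhds hxt] with w hw
      change B (e.symm w) = w
      rw [← heB, e.right_inv hw]
    · have hmem : x ∈ e.source ∩ e ⁻¹' ball (B x) r :=
        ⟨hxe, by rw [mem_preimage, heB]; exact mem_ball_self hr⟩
      filter_upwards [(e.isOpen_inter_preimage isOpen_ball).mem_nhds hmem] with y hy E hE
      refine connectable_of_eventuallyEq (p := B y) ?_ hE.1 (hE.eventuallyEq_symm heB hy.1).symm
      have := hy.2
      rwa [mem_preimage, heB] at this
  refine hc.induction₂ (fun x y => ∀ E E', IsBranchAt B x E → IsBranchAt B y E' →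
    Connectable E E') (fun x hx => ?_) (fun x y z _ hy _ h1 h2 E E' hE hE' => ?_)
    (fun x y _ _ h E E' hE hE' => (h E' E hE' hE).symm) hx hy E E' hE hE'
  · obtain ⟨X, -, hX⟩ := key x hx
    refine (hX.filter_mono nhdsWithin_le_nhds).mono fun y hy E E' hE hE' => ?_
    exact (hX.self_of_nhds E hE).symm.trans (hy E' hE')
  · obtain ⟨X, hX, -⟩ := key y hy
    exact (h1 E X hE hX).trans (h2 X E' hX hE')

end HolElement

/-! ### Taylor series -/

theorem taylorRadius_congr {f g : ℂ → ℂ} {z : ℂ} (h : f =ᶠ[𝓝 z] g) :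
    taylorRadius f z = taylorRadius g z := by
  simp only [taylorRadius, fun k => h.iteratedDeriv_eq k]

theorem AnalyticAt.exists_differentiableOn_eball_taylorRadius {f : ℂ → ℂ} (hf : AnalyticAt ℂ f 0) :
    0 < taylorRadius f 0 ∧ ∃ g : ℂ → ℂ, DifferentiableOn ℂ g (eball 0 (taylorRadius f 0)) ∧
      g =ᶠ[𝓝 0] f := by
  have hp := hf.hasFPowerSeriesAt
  simp only [div_eq_inv_mul] at hp
  set p := FormalMultilinearSeries.ofScalars ℂ
    (fun k : ℕ => ((k.factorial : ℂ)⁻¹ * iteratedDeriv k f 0)) with hpdef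
  have hpos : 0 < p.radius := hp.radius_pos
  refine ⟨hpos, p.sum, (p.hasFPowerSeriesOnBall hpos).differentiableOn, ?_⟩
  filter_upwards [hp.eventually_hasSum] with z hz
  rw [zero_add] at hz
  exact hz.tsum_eq

/-! ### Branches of the inverse of a Blaschke product -/

namespace IsBlaschkeProduct

variable {a c : ℕ → ℂ} {B : ℂ → ℂ}

theorem isBranchAt (hB : IsBlaschkeProduct a c B) (ha : IsPairedBlaschkeSequence a) {n : ℕ}
    {E : HolElement} (hE : E.IsInverseBranch B (a n)) : E.IsBranchAt B (a n) := by
  rw [HolElement.IsBranchAt, hB.apply_eq_zero ha n]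
  exact hE

theorem isPreconnected_regular (hB : IsBlaschkeProduct a c B) (ha : IsPairedBlaschkeSequence a) :
    IsPreconnected {z ∈ ball (0 : ℂ) 1 | deriv B z ≠ 0} :=
  ((hB.differentiableOn ha).deriv isOpen_ball).isPreconnected_setOf_ne_zero isOpen_ball
    (convex_ball 0 1).isPreconnected (ha.mem_disc 0) (hB.deriv_ne_zero ha 0)

theorem connectable (hB : IsBlaschkeProduct a c B) (ha : IsPairedBlaschkeSequence a) {m n : ℕ}
    {E E' : HolElement} (hE : E.IsInverseBranch B (a m)) (hE' : E'.IsInverseBranch B (a n)) :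
    E.Connectable E' :=
  HolElement.connectable_of_isBranchAt isOpen_ball (hB.differentiableOn ha)
    (hB.isPreconnected_regular ha) ⟨ha.mem_disc m, hB.deriv_ne_zero ha m⟩
    ⟨ha.mem_disc n, hB.deriv_ne_zero ha n⟩ (hB.isBranchAt ha hE) (hB.isBranchAt ha hE')

theorem eventuallyEq_of_isInverseBranch (hB : IsBlaschkeProduct a c B)
    (ha : IsPairedBlaschkeSequence a) {n : ℕ} {E E' : HolElement}
    (hE : E.IsInverseBranch B (a n)) (hE' : E'.IsInverseBranch B (a n)) :
    E.toFun =ᶠ[𝓝 0] E'.toFun := by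
  obtain ⟨e, hxe, -, heB, -⟩ := (hB.differentiableOn ha).exists_openPartialHomeomorph isOpen_ball
    (ha.mem_disc n) (hB.deriv_ne_zero ha n)
  have h1 := (hB.isBranchAt ha hE).eventuallyEq_symm heB hxe
  have h2 := (hB.isBranchAt ha hE').eventuallyEq_symm heB hxe
  rw [hB.apply_eq_zero ha] at h1 h2
  exact h1.trans h2.symm

/-- An analytic germ at `0` inverting `B` extends to its disc of convergence as a branch of the
inverse with values in the unit disc. -/
theorem exists_branch_on_eball (hB : IsBlaschkeProduct a c B) (ha : IsPairedBlaschkeSequence a)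
    {f : ℂ → ℂ} (hf : AnalyticAt ℂ f 0) (hf0 : f 0 ∈ ball (0 : ℂ) 1)
    (hBf : ∀ᶠ w in 𝓝 0, B (f w) = w) :
    0 < taylorRadius f 0 ∧ ∃ g : ℂ → ℂ, DifferentiableOn ℂ g (eball 0 (taylorRadius f 0)) ∧
      g =ᶠ[𝓝 0] f ∧ ∀ w ∈ eball 0 (taylorRadius f 0), g w ∈ ball (0 : ℂ) 1 ∧ B (g w) = w := by
  obtain ⟨hpos, g, hg, hgf⟩ := hf.exists_differentiableOn_eball_taylorRadius
  refine ⟨hpos, g, hg, hgf, fun w hw => ?_⟩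
  refine hB.inverseBranch_of_isPreconnected ha isOpen_eball (convex_eball _ _).isPreconnected hg
    (mem_eball_self hpos) (hgf.self_of_nhds ▸ hf0) ?_ hw
  filter_upwards [hgf, hBf] with w h1 h2
  rw [h1, h2]

theorem exists_inverseBranch (hB : IsBlaschkeProduct a c B) (ha : IsPairedBlaschkeSequence a)
    (n : ℕ) : ∃ E : HolElement, E.IsInverseBranch B (a n) ∧
      (E.dom : Set ℂ) = eball 0 (taylorRadius E.toFun 0) ∧
      MapsTo E.toFun E.dom (ball 0 1) ∧ InjOn E.toFun E.dom := by
  obtain ⟨e, hxe, -, heB, hsymm⟩ := (hB.differentiableOn ha).exists_openPartialHomeomorph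
    isOpen_ball (ha.mem_disc n) (hB.deriv_ne_zero ha n)
  have h0 : e (a n) = 0 := by rw [heB, hB.apply_eq_zero ha]
  have h0t : (0 : ℂ) ∈ e.target := h0 ▸ e.map_source hxe
  have hs0 : e.symm 0 = a n := by rw [← h0, e.left_inv hxe]
  obtain ⟨hpos, g, hg, hgf, hgB⟩ := hB.exists_branch_on_eball ha
    (hsymm.analyticAt (e.open_target.mem_nhds h0t)) (hs0 ▸ ha.mem_disc n) (by
      filter_upwards [e.open_target.mem_nhds h0t] with w hw
      rw [← heB, e.right_inv hw])
  refine ⟨HolElement.ofConvex ⟨_, isOpen_eball⟩ (convex_eball _ _) ⟨0, mem_eball_self hpos⟩ g hg,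
    ⟨mem_eball_self hpos, ?_, ?_⟩, ?_, fun w hw => (hgB w hw).1, fun w hw w' hw' h => ?_⟩
  · exact hgf.self_of_nhds.trans hs0
  · filter_upwards [eball_mem_nhds _ hpos] with w hw using (hgB w hw).2
  · change eball 0 _ = eball 0 (taylorRadius g 0)
    rw [taylorRadius_congr hgf]
  · rw [← (hgB w hw).2, ← (hgB w' hw').2]
    exact congrArg B h

theorem radius_le (hB : IsBlaschkeProduct a c B) (ha : IsPairedBlaschkeSequence a) {m n : ℕ}
    (hmn : m ≠ n) {ρ : ℝ} (hρ : 0 < ρ) {g : ℂ → ℂ} (hg : DifferentiableOn ℂ g (ball 0 ρ))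
    (hg0 : g 0 = a m) (hgB : ∀ w ∈ ball (0 : ℂ) ρ, g w ∈ ball (0 : ℂ) 1 ∧ B (g w) = w) :
    ρ ≤ ‖a m - a n‖ / (1 - ‖a m‖) := by
  refine le_trans ?_ (norm_blaschkeFactor_le_div (ha.norm_lt_one m) (ha.norm_lt_one n).le)
  have hbd : ∀ w ∈ ball (0 : ℂ) ρ, w ≠ 0 → ρ ≤ ‖blaschkeFactor (a n) (g w)‖ := by
    intro w hw hw0
    -- Schwarz lemma for `blaschkeFactor (a m) ∘ g`, which fixes `0` and maps the disc of radius `ρ`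
    -- into the unit disc.
    have hS : ‖blaschkeFactor (a m) (g w)‖ ≤ 1 / ρ * ‖w‖ := by
      have h := Complex.dist_le_div_mul_dist_of_mapsTo_ball (c := 0) (R₁ := ρ) (R₂ := 1) (z := w)
        (f := fun w => blaschkeFactor (a m) (g w))
        ((differentiableOn_blaschkeFactor (ha.norm_lt_one m).le).comp hg fun w hw => (hgB w hw).1)
        (fun x hx => by
          rw [hg0, blaschkeFactor_self]
          have h1 := (hgB x hx).1
          simpa using (norm_blaschkeFactor_lt_one (ha.norm_lt_one m)
            (mem_ball_zero_iff.1 h1)).le) hw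
      simpa [hg0, blaschkeFactor_self] using h
    have h1 := hB.norm_le_mul ha (hgB w hw).1 hmn
    rw [(hgB w hw).2] at h1
    have hw' := norm_pos_iff.2 hw0
    have h2 : ‖w‖ * 1 ≤ ‖w‖ * (‖blaschkeFactor (a n) (g w)‖ / ρ) := by
      calc ‖w‖ * 1 = ‖w‖ := mul_one _
        _ ≤ _ := h1
        _ ≤ (1 / ρ * ‖w‖) * ‖blaschkeFactor (a n) (g w)‖ := by gcongr
        _ = _ := by ring
    exact (one_le_div hρ).1 (le_of_mul_le_mul_left h2 hw')
  have hcont : ContinuousAt (fun w => ‖blaschkeFactor (a n) (g w)‖) 0 := by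
    have h1 : ContinuousAt g 0 := (hg.differentiableAt (ball_mem_nhds 0 hρ)).continuousAt
    have h2 : ContinuousAt (blaschkeFactor (a n)) (g 0) :=
      ((differentiableOn_blaschkeFactor (ha.norm_lt_one n).le).differentiableAt
        (isOpen_ball.mem_nhds (hg0 ▸ ha.mem_disc m))).continuousAt
    exact (ContinuousAt.comp (f := g) h2 h1).norm
  rw [← hg0]
  refine ge_of_tendsto (hcont.tendsto.mono_left (nhdsWithin_le_nhds (s := {0}ᶜ))) ?_
  filter_upwards [mem_nhdsWithin_of_mem_nhds (ball_mem_nhds (0 : ℂ) hρ), self_mem_nhdsWithin]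
    with w hw hw0 using hbd w hw hw0

theorem taylorRadius_le (hB : IsBlaschkeProduct a c B) (ha : IsPairedBlaschkeSequence a) {m n : ℕ}
    (hmn : m ≠ n) {E : HolElement} (hE : E.IsInverseBranch B (a m)) :
    taylorRadius E.toFun 0 ≤ ENNReal.ofReal (‖a m - a n‖ / (1 - ‖a m‖)) := by
  obtain ⟨hpos, g, hg, hgf, hgB⟩ := hB.exists_branch_on_eball ha
    (E.holo.analyticAt (E.dom.isOpen.mem_nhds hE.1)) (hE.2.1 ▸ ha.mem_disc m) hE.2.2
  refine ENNReal.le_of_forall_nnreal_lt fun ρ hρ => ?_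
  rcases eq_or_ne ρ 0 with rfl | h0
  · simp
  have hsub : ball (0 : ℂ) ρ ⊆ eball 0 (taylorRadius E.toFun 0) := by
    rw [← eball_coe]
    exact eball_subset_eball hρ.le
  have := hB.radius_le ha hmn (ρ := ρ) (by positivity) (hg.mono hsub)
    (hgf.self_of_nhds.trans hE.2.1) fun w hw => hgB w (hsub hw)
  rw [← ENNReal.ofReal_coe_nnreal]
  exact ENNReal.ofReal_le_ofReal this

/-- The argument gives both bounds with `1` in place of `4`. -/
theorem taylorRadius_even_le (hB : IsBlaschkeProduct a c B) (ha : IsPairedBlaschkeSequence a)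
    {n : ℕ} {E : HolElement} (hE : E.IsInverseBranch B (a (2 * n))) :
    taylorRadius E.toFun 0 ≤
        ENNReal.ofReal (4 * ‖a (2 * n) - a (2 * n + 1)‖ / (1 - ‖a (2 * n)‖)) ∧
      taylorRadius E.toFun 0 ≤ ENNReal.ofReal (4 * (1 - ‖a (2 * n)‖)) := by
  have h := hB.taylorRadius_le ha (n := 2 * n + 1) (by omega) hE
  have h0 : 0 < 1 - ‖a (2 * n)‖ := by linarith [ha.norm_lt_one (2 * n)]
  refine ⟨h.trans (ENNReal.ofReal_le_ofReal ?_), h.trans (ENNReal.ofReal_le_ofReal ?_)⟩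
  · gcongr
    linarith [norm_nonneg (a (2 * n) - a (2 * n + 1))]
  · linarith [ha.pair_div_le n]

theorem tendsto_taylorRadius (hB : IsBlaschkeProduct a c B) (ha : IsPairedBlaschkeSequence a)
    {E : ℕ → HolElement} (hE : ∀ n, (E n).IsInverseBranch B (a n)) :
    Tendsto (fun n => taylorRadius (E (2 * n)).toFun 0) atTop (𝓝 0) := by
  refine tendsto_of_tendsto_of_tendsto_of_le_of_le tendsto_const_nhds ?_ (fun _ => zero_le)
    fun n => (hB.taylorRadius_even_le ha (hE (2 * n))).2
  have := (ha.tendsto_one_sub_norm_even).const_mul 4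
  simpa using ENNReal.tendsto_ofReal this

end IsBlaschkeProduct

/-! ### Regular continuations -/

namespace RegularContinuation

variable {E : HolElement}

theorem exists_chart (Q : RegularContinuation.{u} E) (s : Q.S) :
    ∃ e : OpenPartialHomeomorph Q.S ℂ, s ∈ e.source ∧ (∀ x ∈ e.source, e x = Q.proj x) ∧
      DifferentiableOn ℂ (fun w => Q.F (e.symm w)) e.target := by
  obtain ⟨Φ, hs, hΦ⟩ := Q.proj_local s
  refine ⟨Φ.toOpenPartialHomeomorph, hs, fun x hx => (hΦ hx).symm, ?_⟩
  rw [← mdifferentiableOn_iff_differentiableOn]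
  have h : MDifferentiableOn 𝓘(ℂ) 𝓘(ℂ) Φ.invFun Φ.target :=
    Φ.contMDiffOn_invFun.mdifferentiableOn (by simp)
  exact Q.F_holo.comp_mdifferentiableOn h

/-- The inclusion of an open subset of `ℂ`, lifted to an arbitrary universe. -/
def uliftVal (V : TopologicalSpace.Opens ℂ) (s : ULift.{u} V) : ℂ := s.down.1

theorem isOpenEmbedding_uliftVal (V : TopologicalSpace.Opens ℂ) :
    Topology.IsOpenEmbedding (uliftVal.{u} V) :=
  V.isOpen.isOpenEmbedding_subtypeVal.comp Homeomorph.ulift.isOpenEmbedding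

/-- A nonempty open subset of `ℂ`, lifted to an arbitrary universe, as a Riemann surface. -/
noncomputable instance (V : TopologicalSpace.Opens ℂ) [Nonempty V] :
    ChartedSpace ℂ (ULift.{u} V) :=
  (isOpenEmbedding_uliftVal V).singletonChartedSpace

instance (V : TopologicalSpace.Opens ℂ) [Nonempty V] : IsManifold 𝓘(ℂ) ω (ULift.{u} V) :=
  (isOpenEmbedding_uliftVal V).isManifold_singleton

theorem isLocalDiffeomorph_uliftVal (V : TopologicalSpace.Opens ℂ) [Nonempty V] :
    IsLocalDiffeomorph 𝓘(ℂ) 𝓘(ℂ) ω (uliftVal.{u} V) := by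
  intro s
  let e := (isOpenEmbedding_uliftVal.{u} V).toOpenPartialHomeomorph
  let Φ : PartialDiffeomorph 𝓘(ℂ) 𝓘(ℂ) (ULift.{u} V) ℂ ω :=
    { toPartialEquiv := e.toPartialEquiv
      open_source := e.open_source
      open_target := e.open_target
      contMDiffOn_toFun := (contMDiff_isOpenEmbedding (isOpenEmbedding_uliftVal V)).contMDiffOn
      contMDiffOn_invFun := by
        have h := contMDiffOn_isOpenEmbedding_symm (I := 𝓘(ℂ)) (n := ω)
          (isOpenEmbedding_uliftVal.{u} V)
        rwa [← (isOpenEmbedding_uliftVal.{u} V).toOpenPartialHomeomorph_target] at h }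
  exact ⟨Φ, mem_univ s, fun x _ => rfl⟩

theorem mdifferentiable_of_uliftVal_comp {M : Type*} [TopologicalSpace M] [ChartedSpace ℂ M]
    (V : TopologicalSpace.Opens ℂ) [Nonempty V] {φ : M → ULift.{u} V}
    (hφ : MDifferentiable 𝓘(ℂ) 𝓘(ℂ) fun x => uliftVal V (φ x)) :
    MDifferentiable 𝓘(ℂ) 𝓘(ℂ) φ := by
  intro x
  have hemb := isOpenEmbedding_uliftVal.{u} V
  have hsymm : MDifferentiableAt 𝓘(ℂ) 𝓘(ℂ) hemb.toOpenPartialHomeomorph.symm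
      (uliftVal V (φ x)) :=
    ((contMDiffOn_isOpenEmbedding_symm (I := 𝓘(ℂ)) (n := ω) hemb).contMDiffAt
      (hemb.isOpen_range.mem_nhds (mem_range_self _))).mdifferentiableAt (by simp)
  have h := hsymm.comp x (hφ x)
  convert h using 1
  ext y
  exact congrArg (uliftVal V) (hemb.toOpenPartialHomeomorph.left_inv (mem_univ (φ y))).symm

theorem isLocalDiffeomorphAt_of_deriv_ne_zero {p : ℂ → ℂ} {V : Set ℂ} (hV : IsOpen V)
    (hp : DifferentiableOn ℂ p V) {z : ℂ} (hz : z ∈ V) (hd : deriv p z ≠ 0) :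
    IsLocalDiffeomorphAt 𝓘(ℂ) 𝓘(ℂ) ω p z := by
  obtain ⟨e, hze, hes, hep, hsymm⟩ := hp.exists_openPartialHomeomorph hV hz hd
  let Φ : PartialDiffeomorph 𝓘(ℂ) 𝓘(ℂ) ℂ ℂ ω :=
    { toPartialEquiv := e.toPartialEquiv
      open_source := e.open_source
      open_target := e.open_target
      contMDiffOn_toFun := by
        refine ContDiffOn.contMDiffOn (ContDiffOn.congr ?_ fun w _ => hep w)
        exact (hp.mono fun w hw => (hes hw).1).contDiffOn e.open_source
      contMDiffOn_invFun := (hsymm.contDiffOn e.open_target).contMDiffOn }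
  exact ⟨Φ, hze, fun w _ => (hep w).symm⟩

/-- The regular continuation with total space an open connected set `V ⊆ ℂ`, whose projection is a
locally biholomorphic function `p` on `V` inverted by the element `E`. -/
noncomputable def ofLocallyInjective (E : HolElement) (V : TopologicalSpace.Opens ℂ)
    (hVc : IsConnected (V : Set ℂ)) (p : ℂ → ℂ) (hp : DifferentiableOn ℂ p V)
    (hp' : ∀ z ∈ V, deriv p z ≠ 0) (hEV : ∀ z ∈ E.dom, E.toFun z ∈ V)
    (hpE : ∀ z ∈ E.dom, p (E.toFun z) = z) : RegularContinuation.{u} E :=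
  haveI : Nonempty V := hVc.nonempty.to_subtype
  haveI : ConnectedSpace V := isConnected_iff_connectedSpace.1 hVc
  { S := ULift.{u} V
    connected := Homeomorph.ulift.symm.surjective.connectedSpace Homeomorph.ulift.symm.continuous
    proj := p ∘ uliftVal V
    proj_local := fun s => (isLocalDiffeomorph_uliftVal V s).comp 𝓘(ℂ) ℂ
      (isLocalDiffeomorphAt_of_deriv_ne_zero V.isOpen hp s.down.2 (hp' _ s.down.2))
    incl := fun z => ULift.up ⟨E.toFun z, hEV z z.2⟩
    incl_holo := mdifferentiable_of_uliftVal_comp V fun z => by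
      have h1 : MDifferentiableAt 𝓘(ℂ) 𝓘(ℂ) E.toFun (z : ℂ) :=
        (E.differentiableAt z.2).mdifferentiableAt
      have h2 : MDifferentiableAt 𝓘(ℂ) 𝓘(ℂ) (Subtype.val : E.dom → ℂ) z :=
        (contMDiff_subtype_val (n := 1) z).mdifferentiableAt (by simp)
      exact h1.comp z h2
    proj_incl := fun z => hpE z z.2
    F := uliftVal V
    F_holo := (isLocalDiffeomorph_uliftVal V).mdifferentiable (by simp)
    F_incl := fun z => rfl }

/-- The required map into `V` is `Q.F` itself. -/
theorem ofLocallyInjective_isMaximal (E : HolElement) (V : TopologicalSpace.Opens ℂ)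
    (hVc : IsConnected (V : Set ℂ)) (p : ℂ → ℂ) (hp : DifferentiableOn ℂ p V)
    (hp' : ∀ z ∈ V, deriv p z ≠ 0) (hEV : ∀ z ∈ E.dom, E.toFun z ∈ V)
    (hpE : ∀ z ∈ E.dom, p (E.toFun z) = z)
    (hQ : ∀ (Q : RegularContinuation.{u} E) (s : Q.S), Q.F s ∈ V ∧ p (Q.F s) = Q.proj s) :
    (ofLocallyInjective.{u} E V hVc p hp hp' hEV hpE).IsMaximal := by
  intro Q
  have : Nonempty V := hVc.nonempty.to_subtype
  refine ⟨fun s => ULift.up ⟨Q.F s, (hQ Q s).1⟩, mdifferentiable_of_uliftVal_comp V Q.F_holo,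
    fun s => (hQ Q s).2, fun z => ?_, fun s => rfl⟩
  exact ULift.down_injective (Subtype.ext (Q.F_incl z))

end RegularContinuation

/-! ### The maximal continuation of a branch of the inverse -/

namespace IsBlaschkeProduct

variable {a c : ℕ → ℂ} {B : ℂ → ℂ} {E : HolElement} {n : ℕ}

/-- In a chart given by the projection, `F` becomes a function on a plane disc. If it inverts `B`
near one point there, it does so on the whole disc, with values in the regular set. Hence the good
set `G` is clopen. -/
theorem continuation_mem (hB : IsBlaschkeProduct a c B) (ha : IsPairedBlaschkeSequence a)
    (hE : E.IsInverseBranch B (a n)) (Q : RegularContinuation.{u} E) (s : Q.S) :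
    (Q.F s ∈ ball (0 : ℂ) 1 ∧ deriv B (Q.F s) ≠ 0) ∧ B (Q.F s) = Q.proj s := by
  set G : Set Q.S := {s | Q.F s ∈ ball (0 : ℂ) 1 ∧ ∀ᶠ x in 𝓝 s, B (Q.F x) = Q.proj x} with hG
  have key : ∀ s, ∃ N : Set Q.S, IsOpen N ∧ s ∈ N ∧ ((N ∩ G).Nonempty →
      ∀ x ∈ N, (Q.F x ∈ ball (0 : ℂ) 1 ∧ deriv B (Q.F x) ≠ 0) ∧ B (Q.F x) = Q.proj x) := by
    intro s
    obtain ⟨e, hse, heq, hd⟩ := Q.exists_chart s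
    obtain ⟨r, hr, hsub⟩ := Metric.isOpen_iff.1 e.open_target _ (e.map_source hse)
    refine ⟨e.source ∩ e ⁻¹' ball (e s) r, e.isOpen_inter_preimage isOpen_ball,
      ⟨hse, mem_ball_self hr⟩, ?_⟩
    rintro ⟨y, ⟨hye, hyr⟩, hy1, hy2⟩
    have hbr : ∀ w ∈ ball (e s) r, Q.F (e.symm w) ∈ ball (0 : ℂ) 1 ∧ B (Q.F (e.symm w)) = w := by
      intro w hw
      refine hB.inverseBranch_of_isPreconnected ha isOpen_ball (convex_ball _ r).isPreconnected
        (hd.mono hsub) hyr ?_ ?_ hw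
      · rwa [e.left_inv hye]
      · have hcont : Tendsto e.symm (𝓝 (e y)) (𝓝 y) := by
          have := (e.continuousAt_symm (hsub hyr)).tendsto
          rwa [e.left_inv hye] at this
        filter_upwards [hcont.eventually hy2, e.open_target.mem_nhds (hsub hyr)] with x hx hxt
        rw [hx, ← heq _ (e.map_target hxt), e.right_inv hxt]
    rintro x ⟨hxe, hxr⟩
    obtain ⟨h1, h2⟩ := hbr _ hxr
    have h3 := (deriv_ne_zero_of_eventually_comp_eq (hB.analyticAt ha h1).differentiableAt
      (hd.differentiableAt (e.open_target.mem_nhds (hsub hxr)))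
      (by filter_upwards [isOpen_ball.mem_nhds hxr] with w hw using (hbr w hw).2)).1
    rw [e.left_inv hxe] at h1 h2 h3
    exact ⟨⟨h1, h3⟩, h2.trans (heq x hxe)⟩
  have hNG : ∀ s, ∃ N ∈ 𝓝 s, (N ∩ G).Nonempty → N ⊆ G := by
    intro s
    obtain ⟨N, hN, hsN, h⟩ := key s
    exact ⟨N, hN.mem_nhds hsN, fun hne x hx => ⟨(h hne x hx).1.1,
      mem_of_superset (hN.mem_nhds hx) fun y hy => (h hne y hy).2⟩⟩
  have hclopen : IsClopen G := by
    constructor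
    · refine isClosed_of_closure_subset fun s hs => ?_
      obtain ⟨N, hN, h⟩ := hNG s
      exact h (mem_closure_iff_nhds.1 hs N hN) (mem_of_mem_nhds hN)
    · refine isOpen_iff_mem_nhds.2 fun s hs => ?_
      obtain ⟨N, hN, h⟩ := hNG s
      exact mem_of_superset hN (h ⟨s, mem_of_mem_nhds hN, hs⟩)
  have hne : Q.incl ⟨0, hE.1⟩ ∈ G := by
    refine ⟨by rw [Q.F_incl, hE.2.1]; exact ha.mem_disc n, ?_⟩
    obtain ⟨e, hse, heq, -⟩ := Q.exists_chart (Q.incl ⟨0, hE.1⟩)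
    have hproj : Tendsto Q.proj (𝓝 (Q.incl ⟨0, hE.1⟩)) (𝓝 0) := by
      have h := Q.proj_local.contMDiff.continuous.tendsto (Q.incl ⟨0, hE.1⟩)
      rwa [Q.proj_incl] at h
    have hinc : ∀ᶠ w in 𝓝 (0 : ℂ), ∃ h : w ∈ E.dom, Q.incl ⟨w, h⟩ ∈ e.source := by
      have h1 := Q.incl_holo.continuous.continuousAt.eventually (e.open_source.mem_nhds hse)
      rw [nhds_subtype_eq_comap, eventually_comap] at h1
      filter_upwards [h1, E.dom.isOpen.mem_nhds hE.1] with w hw hwE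
      exact ⟨hwE, hw ⟨w, hwE⟩ rfl⟩
    filter_upwards [hproj.eventually hinc, hproj.eventually hE.2.2, e.open_source.mem_nhds hse]
      with x hx hBx hxe
    obtain ⟨h, hx⟩ := hx
    -- Both points lie in a chart domain on which the projection is injective, so near the base
    -- point every `x` comes from `E.dom`.
    have : Q.incl ⟨Q.proj x, h⟩ = x :=
      e.injOn hx hxe (by rw [heq _ hx, heq _ hxe, Q.proj_incl])
    rw [← hBx, ← Q.F_incl ⟨Q.proj x, h⟩, this]
  have huniv : G = univ := hclopen.eq_univ ⟨_, hne⟩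
  obtain ⟨N, hN, hsN, h⟩ := key s
  exact h ⟨s, hsN, huniv ▸ mem_univ s⟩ s hsN

/-- The set of points of the unit disc at which `B` is locally injective. -/
def regularOpens (hB : IsBlaschkeProduct a c B) (ha : IsPairedBlaschkeSequence a) :
    TopologicalSpace.Opens ℂ where
  carrier := {z ∈ ball (0 : ℂ) 1 | deriv B z ≠ 0}
  is_open' := ((hB.differentiableOn ha).deriv isOpen_ball).continuousOn.isOpen_inter_preimage
    isOpen_ball isOpen_compl_singleton

theorem inverseBranch_mem (hB : IsBlaschkeProduct a c B) (ha : IsPairedBlaschkeSequence a)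
    (hE : E.IsInverseBranch B (a n)) {z : ℂ} (hz : z ∈ E.dom) :
    E.toFun z ∈ hB.regularOpens ha ∧ B (E.toFun z) = z := by
  have h : ∀ z ∈ E.dom, E.toFun z ∈ ball (0 : ℂ) 1 ∧ B (E.toFun z) = z := fun z hz =>
    hB.inverseBranch_of_isPreconnected ha E.dom.isOpen E.isPreconnected_dom E.holo hE.1
      (hE.2.1 ▸ ha.mem_disc n) hE.2.2 hz
  refine ⟨⟨(h z hz).1, ?_⟩, (h z hz).2⟩
  refine (deriv_ne_zero_of_eventually_comp_eq (hB.analyticAt ha (h z hz).1).differentiableAt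
    (E.differentiableAt hz) ?_).1
  filter_upwards [E.dom.isOpen.mem_nhds hz] with w hw using (h w hw).2

/-- The maximal regular continuation of a branch of the inverse of `B`: its total space is the
set of points of the disc at which `B` is locally injective, with `B` as projection. -/
noncomputable def maximalContinuation (hB : IsBlaschkeProduct a c B)
    (ha : IsPairedBlaschkeSequence a) (hE : E.IsInverseBranch B (a n)) :
    RegularContinuation.{u} E :=
  RegularContinuation.ofLocallyInjective E (hB.regularOpens ha)
    ⟨⟨a 0, ha.mem_disc 0, hB.deriv_ne_zero ha 0⟩, hB.isPreconnected_regular ha⟩ B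
    ((hB.differentiableOn ha).mono fun _ hz => hz.1) (fun _ hz => hz.2)
    (fun _ hz => (hB.inverseBranch_mem ha hE hz).1) fun _ hz => (hB.inverseBranch_mem ha hE hz).2

theorem maximalContinuation_isMaximal (hB : IsBlaschkeProduct a c B)
    (ha : IsPairedBlaschkeSequence a) (hE : E.IsInverseBranch B (a n)) :
    (hB.maximalContinuation.{u} ha hE).IsMaximal :=
  RegularContinuation.ofLocallyInjective_isMaximal _ _ _ _ _ _ _ _
    fun Q s => hB.continuation_mem ha hE Q s

theorem not_isCovering (hB : IsBlaschkeProduct a c B) (ha : IsPairedBlaschkeSequence a)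
    (hE : E.IsInverseBranch B (a n)) {Q : RegularContinuation.{u} E} (hQ : Q.IsMaximal) :
    ¬ Q.IsCovering := by
  intro hcov
  -- Comparison with the explicit model produces, for every `k`, a point of `Q.S` over `0` at which
  -- `F` equals `a k`.
  obtain ⟨φ, -, hφp, -, hφF⟩ := hQ (hB.maximalContinuation ha hE)
  have hpt : ∀ k, ∃ s : Q.S, Q.proj s = 0 ∧ Q.F s = a k := fun k =>
    ⟨φ (ULift.up ⟨a k, ha.mem_disc k, hB.deriv_ne_zero ha k⟩),
      (hφp _).trans (hB.apply_eq_zero ha k), hφF _⟩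
  choose s hs0 hsF using hpt
  obtain ⟨-, U, hxU, hU, -, H, hH⟩ := hcov ⟨0, s 0, hs0 0⟩
  have hUo : IsOpen (Subtype.val '' U) :=
    Q.proj_local.isOpen_range.isOpenMap_subtype_val U hU
  obtain ⟨ρ, hρ, hsub⟩ := Metric.isOpen_iff.1 hUo 0 ⟨_, hxU, rfl⟩
  have hmem : ∀ w : ball (0 : ℂ) ρ, ∃ h : (w : ℂ) ∈ range Q.proj, (⟨w, h⟩ : range Q.proj) ∈ U := by
    intro w
    obtain ⟨x, hx, hxw⟩ := hsub w.2
    exact ⟨hxw ▸ x.2, by rwa [show (⟨w, hxw ▸ x.2⟩ : range Q.proj) = x from Subtype.ext hxw.symm]⟩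
  let ι : ball (0 : ℂ) ρ → U := fun w => ⟨⟨w, (hmem w).1⟩, (hmem w).2⟩
  have hι : Continuous ι := by fun_prop
  have hbound : ∀ k, ρ ≤ 1 - ‖a (2 * k)‖ := by
    intro k
    have hsU : rangeFactorization Q.proj (s (2 * k)) ∈ U := by
      convert hxU
      exact Subtype.ext (hs0 (2 * k))
    let i := (H ⟨s (2 * k), hsU⟩).2
    -- The section over the disc in the sheet through `s (2 * k)`; the radius `ρ` does not depend on
    -- `k`.
    let σ : ball (0 : ℂ) ρ → Q.S := fun w => (H.symm (ι w, i)).1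
    have hσ : Continuous σ := by fun_prop
    have hσp : ∀ w, Q.proj (σ w) = w := by
      intro w
      have h := hH (H.symm (ι w, i))
      rw [H.apply_symm_apply] at h
      exact (congrArg Subtype.val h).symm
    have hσ0 : σ ⟨0, mem_ball_self hρ⟩ = s (2 * k) := by
      have h : (ι ⟨0, mem_ball_self hρ⟩, i) = H ⟨s (2 * k), hsU⟩ := by
        refine Prod.ext (Subtype.ext (Subtype.ext ?_)) rfl
        rw [hH]
        exact (hs0 (2 * k)).symm
      simp only [σ, h, H.symm_apply_apply]
    let g : ℂ → ℂ := Function.extend Subtype.val (fun w => Q.F (σ w)) 0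
    have hg : ∀ w : ball (0 : ℂ) ρ, g w = Q.F (σ w) := fun w =>
      Subtype.val_injective.extend_apply _ _ w
    have hgc : ContinuousOn g (ball 0 ρ) := by
      rw [continuousOn_iff_continuous_domRestrict]
      exact (Q.F_holo.continuous.comp hσ).congr fun w => (hg w).symm
    have hgB : ∀ w ∈ ball (0 : ℂ) ρ,
        (g w ∈ ball (0 : ℂ) 1 ∧ deriv B (g w) ≠ 0) ∧ B (g w) = w := by
      intro w hw
      have h := hB.continuation_mem ha hE Q (σ ⟨w, hw⟩)
      rwa [← hg ⟨w, hw⟩, hσp] at h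
    have hgd : DifferentiableOn ℂ g (ball 0 ρ) := by
      intro w hw
      have hw' := isOpen_ball.mem_nhds hw
      -- A continuous right inverse of `B` through points with `B' ≠ 0` is automatically
      -- holomorphic, so continuity of the section suffices.
      refine (HasDerivAt.of_local_left_inverse (hgc.continuousAt hw')
        (hB.analyticAt ha (hgB w hw).1.1).differentiableAt.hasDerivAt (hgB w hw).1.2
        ?_).differentiableAt.differentiableWithinAt
      filter_upwards [hw'] with x hx using (hgB x hx).2
    refine (hB.radius_le ha (n := 2 * k + 1) (by omega) hρ hgd ?_ fun w hw =>
      ⟨(hgB w hw).1.1, (hgB w hw).2⟩).trans (ha.pair_div_le k)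
    rw [hg ⟨0, mem_ball_self hρ⟩, hσ0, hsF]
  exact hρ.not_ge (ge_of_tendsto' ha.tendsto_one_sub_norm_even hbound)

end IsBlaschkeProduct

theorem mainTheorem1 :
    (∃ a : ℕ → ℂ, IsPairedBlaschkeSequence a) ∧
    ∀ a : ℕ → ℂ, IsPairedBlaschkeSequence a →
      (∃ B : ℂ → ℂ, IsBlaschkeProduct a (fun n => blaschkeConst (a n)) B) ∧
      ∀ (c : ℕ → ℂ) (B : ℂ → ℂ), IsBlaschkeProduct a c B →
        -- `B` is a holomorphic self-map of the disc whose zeros are exactly the `a n`, all simple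
        DifferentiableOn ℂ B (Metric.ball 0 1) ∧
        Set.MapsTo B (Metric.ball 0 1) (Metric.ball 0 1) ∧
        (∀ z ∈ Metric.ball (0 : ℂ) 1, B z = 0 ↔ ∃ n, a n = z) ∧
        (∀ n, deriv B (a n) ≠ 0) ∧
        -- the unit circle is a natural boundary of `B`
        (∀ D : HolElement, (D.dom : Set ℂ) = Metric.ball 0 1 →
          Set.EqOn D.toFun B (Metric.ball 0 1) → D.HasNaturalBoundary) ∧
        -- the branch `f n` exists on its disc of convergence, and maps it injectively into the disc
        (∀ n, ∃ E : HolElement, E.IsInverseBranch B (a n) ∧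
          (E.dom : Set ℂ) = Metric.eball 0 (taylorRadius E.toFun 0) ∧
          Set.MapsTo E.toFun E.dom (Metric.ball 0 1) ∧ Set.InjOn E.toFun E.dom) ∧
        -- its germ at `0` is unique
        (∀ n, ∀ E E' : HolElement, E.IsInverseBranch B (a n) → E'.IsInverseBranch B (a n) →
          E.toFun =ᶠ[𝓝 0] E'.toFun) ∧
        -- all branches are connectable
        (∀ m n, ∀ E E' : HolElement, E.IsInverseBranch B (a m) → E'.IsInverseBranch B (a n) →
          E.Connectable E') ∧
        -- bounds on the radii of convergence `r (2 * n)`, which tend to `0`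
        (∀ n, ∀ E : HolElement, E.IsInverseBranch B (a (2 * n)) →
          taylorRadius E.toFun 0 ≤
            ENNReal.ofReal (4 * ‖a (2 * n) - a (2 * n + 1)‖ / (1 - ‖a (2 * n)‖)) ∧
          taylorRadius E.toFun 0 ≤ ENNReal.ofReal (4 * (1 - ‖a (2 * n)‖))) ∧
        (∀ E : ℕ → HolElement, (∀ n, (E n).IsInverseBranch B (a n)) →
          Filter.Tendsto (fun n => taylorRadius (E (2 * n)).toFun 0) Filter.atTop (𝓝 0)) ∧
        -- the maximal continuation exists and its projection is not a covering of its image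
        (∀ n, ∀ E : HolElement, E.IsInverseBranch B (a n) →
          (∃ Q : RegularContinuation.{u} E, Q.IsMaximal) ∧
          ∀ Q : RegularContinuation.{u} E, Q.IsMaximal → ¬ Q.IsCovering) := by
  refine ⟨exists_isPairedBlaschkeSequence, fun a ha => ⟨ha.exists_isBlaschkeProduct,
    fun c B hB => ⟨hB.differentiableOn ha, hB.mapsTo ha, fun z hz => hB.apply_eq_zero_iff ha hz,
      hB.deriv_ne_zero ha, fun D hD heq => hB.hasNaturalBoundary ha hD heq,
      hB.exists_inverseBranch ha,
      fun n E E' hE hE' => hB.eventuallyEq_of_isInverseBranch ha hE hE',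
      fun m n E E' hE hE' => hB.connectable ha hE hE',
      fun n E hE => hB.taylorRadius_even_le ha hE,
      fun E hE => hB.tendsto_taylorRadius ha hE,
      fun n E hE => ⟨⟨_, hB.maximalContinuation_isMaximal ha hE⟩,
        fun Q hQ => hB.not_isCovering ha hE hQ⟩⟩⟩⟩
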